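/- Let $\mathbb T=\mathbb R/\mathbb Z$, let $g$ be a smooth Riemannian metric on $\mathbb T^2=\mathbb R^2/\mathbb Z^2$ and $\sigma$ a smooth 2-form on $\mathbb T^2$ that takes both positive and negative values. Let $\mathcal M=H^1(\mathbb T,\mathbb T^2)\times(0,\infty)$ be the Hilbert manifold of $H^1$-loops $\gamma=(x,T)$ with arbitrary period. Write $\gamma^n=(x(n\,\cdot),nT)$ for the $n$-th iterate, $n\ge 1$, and $\mathbb T\cdot\gamma=\{(x(\psi+\cdot),T):\psi\in\mathbb T\}$. For $k>0$ let $$\eta_k(x,T)=d\mathbb A_k(x,T)+\int_0^1\sigma_{x(s)}(\,\cdot\,,x'(s))\,ds,\qquad \mathbb A_k(x,T)=\frac1{2T}\int_0^1|x'(s)|^2ds+kT,$$ which is a closed 1-form on $\mathcal M$, and let $\tau$ be the closed 1-form $\tau_{(x,T)}=\int_0^1\bar\sigma(\,\cdot\,,x'(s))\,ds$ with $\bar\sigma=dq^1\wedge dq^2$. Integrals of closed 1-forms along continuous paths are defined by means of local primitives. Let $k^*>0$ and let $\alpha=(x_\alpha,T_\alpha)\in\mathcal M$ be a non-contractible loop.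 Choose a point $q_0\in\mathbb T^2$ not on $\alpha$ and a smooth 1-form $\theta$ on $\mathbb T^2\setminus\{q_0\}$ with $d\theta=\sigma$. On the open set $\mathcal V\subset\mathcal M$ of the loops avoiding $q_0$ let $$\mathbb S_k(x,T)=T\int_0^1\Big(\tfrac1{2T^2}|x'(s)|^2+\tfrac1T\theta_{x(s)}(x'(s))+k\Big)ds ,$$ a primitive of $\eta_k|_{\mathcal V}$. Assume that $\alpha$ is a strict local minimizer of the action with energy $k^*$: there is an open neighbourhood of $\mathbb T\cdot\alpha$ in $\mathcal V$ on which $\mathbb S_{k^*}\ge\mathbb S_{k^*}(\alpha)$, with strict inequality off $\mathbb T\cdot\alpha$. Let $\mathcal U$ be a bounded open neighbourhood of $\mathbb T\cdot\alpha$ with $\overline{\mathcal U}\subset\mathcal V$ and $\inf_{\partial\mathcal U}\mathbb S_{k^*}>\mathbb S_{k^*}(\alpha)$, and let $M_k$ be the closure of the set of local minimizers of $\mathbb S_k$ in $\mathcal U$. Let $I\subset(0,\infty)$ be an open interval containing $k^*$ such that 1. for every $k\in I$ the set $M_k$ is non-empty and compact; 2. for all $k_-<k_+$ in $I$ and all $\beta\in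 M_{k_+}$ there is a continuous path $w:[0,1]\to\mathcal U$ with $w(0)\in M_{k_-}$, $w(1)=\beta$ and $\mathbb S_{k_-}\circ w\le\mathbb S_{k_-}(\beta)$. For $n\ge1$ let $\mathcal N^n$ be the connected component of $\mathcal M$ containing $\alpha^n$, let $M_k^n=\{\beta^n:\beta\in M_k\}$, and for $k\in I$ let $$\mathcal P_n(k)=\Big\{u:[0,1]\to\mathcal N^n\text{ continuous}\ \Big|\ u(0)=u(1)\in M_k^n,\ \int_0^1u^*\tau\ne0\Big\},$$ $$\mathbb S_k(u,s)=\mathbb S_k(u(0))+\int_0^su^*\eta_k,\qquad c_n(k)=\inf_{u\in\mathcal P_n(k)}\ \max_{s\in[0,1]}\mathbb S_k(u,s),$$ the infimum being taken in the extended real numbers. Then for every integer $n\ge1$ and all $k_-,k_+\in I$ with $k_-<k_+$ one has $c_n(k_-)\le c_n(k_+)$. -/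

import Mathlib

open MeasureTheory Set Filter Topology
open scoped ContDiff

noncomputable section

namespace MagneticTorus

/-! ### The torus, Riemannian metrics and differential forms on it -/

/-- The Euclidean plane, which is also the model of every tangent space of the torus. -/
abbrev Plane : Type := EuclideanSpace ℝ (Fin 2)

/-- The two-torus `ℝ² / ℤ²`. -/
abbrev Torus : Type := Fin 2 → UnitAddCircle

/-- The universal covering `ℝ² → ℝ² / ℤ²`. -/
def proj (p : Plane) : Torus := fun i => ((p i : ℝ) : UnitAddCircle)

/-- A smooth Riemannian metric on the torus, written in the Cartesian frame. -/
structure TorusMetric where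
  val : Torus → Plane →L[ℝ] Plane →L[ℝ] ℝ
  smooth : ContDiff ℝ ∞ (fun p : Plane => val (proj p))
  symm : ∀ q u v, val q u v = val q v u
  pos : ∀ q v, v ≠ 0 → 0 < val q v v

/-- The standard area form `dq¹ ∧ dq²` on `ℝ²`. -/
def area (u v : Plane) : ℝ := u 0 * v 1 - u 1 * v 0

/-- A smooth 2-form on the torus, `coeff · dq¹ ∧ dq²`. -/
structure TwoForm where
  coeff : Torus → ℝ
  smooth : ContDiff ℝ ∞ (fun p : Plane => coeff (proj p))

/-- The value `σ_q(u, v)`. -/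
def TwoForm.eval (σ : TwoForm) (q : Torus) (u v : Plane) : ℝ := σ.coeff q * area u v

/-- The form takes both signs. -/
def TwoForm.Oscillating (σ : TwoForm) : Prop :=
  (∃ q, σ.coeff q < 0) ∧ ∃ q, 0 < σ.coeff q

/-- The form `dq¹ ∧ dq²` on the torus. -/
def stdArea : TwoForm where
  coeff := fun _ => 1
  smooth := contDiff_const

/-- `θ` is a smooth 1-form on the torus minus the point `q₀` with `dθ = σ` there
(the value of `θ` at `q₀` is irrelevant). -/
structure IsPrimitiveAway (σ : TwoForm) (q₀ : Torus) (θ : Torus → Plane →L[ℝ] ℝ) : Prop where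
  smooth : ContDiffOn ℝ ∞ (fun p : Plane => θ (proj p)) {p | proj p ≠ q₀}
  d_eq : ∀ p : Plane, proj p ≠ q₀ → ∀ u v : Plane,
    fderiv ℝ (fun p : Plane => θ (proj p)) p u v - fderiv ℝ (fun p : Plane => θ (proj p)) p v u
      = σ.eval (proj p) u v

/-! ### Loops of class `H¹` -/

/-- Square-integrable vector fields `𝕋 → ℝ²`. -/
abbrev L2 : Type := Lp Plane 2 (volume : Measure UnitAddCircle)

lemma proj_add (p q : Plane) : proj (p + q) = proj p + proj q := by
  ext i; simp [proj]

lemma proj_neg (p : Plane) : proj (-p) = - proj p := by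
  ext i; simp [proj]

lemma proj_zero : proj 0 = 0 := by
  ext i; simp [proj]

lemma continuous_proj : Continuous proj :=
  continuous_pi fun i =>
    (AddCircle.continuous_mk' 1).comp (by fun_prop : Continuous fun p : Plane => p i)

lemma quasi_mk : Measure.QuasiMeasurePreserving (fun r : ℝ => (r : UnitAddCircle)) := by
  refine ⟨AddCircle.measurable_mk', ?_⟩
  refine Measure.AbsolutelyContinuous.mk fun s hs h0 => ?_
  rw [Measure.map_apply AddCircle.measurable_mk' hs]
  have hcov : ((fun r : ℝ => (r : UnitAddCircle)) ⁻¹' s)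
      ⊆ ⋃ n : ℤ, ((fun r : ℝ => (r : UnitAddCircle)) ⁻¹' s) ∩ Ioc (n : ℝ) (n + 1) := by
    intro r hr
    refine mem_iUnion.2 ⟨⌈r⌉ - 1, hr, ?_, ?_⟩
    · push_cast; linarith [Int.ceil_lt_add_one r]
    · push_cast; linarith [Int.le_ceil r]
  refine measure_mono_null hcov (measure_iUnion_null fun n => ?_)
  have h := (AddCircle.add_projection_respects_measure 1 (n : ℝ) hs)
  rw [h0] at h
  exact h.symm

lemma intervalIntegrable_vel (v : L2) (a b : ℝ) :
    IntervalIntegrable (fun r : ℝ => v (r : UnitAddCircle)) volume a b := by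
  have hint : Integrable (v : UnitAddCircle → Plane) volume :=
    (Lp.memLp v).integrable (by norm_num)
  have hper : Function.Periodic (fun r : ℝ => v (r : UnitAddCircle)) 1 := by
    intro r; simp
  refine hper.intervalIntegrable₀ one_ne_zero ?_ a b
  rw [intervalIntegrable_iff_integrableOn_Ioc_of_le zero_le_one]
  have h := (UnitAddCircle.measurePreserving_mk 0).integrable_comp_of_integrable hint
  simpa [IntegrableOn, Function.comp_def] using! h

/-- The displacement `∫₀ᵗ v` in `ℝ²`. -/
def displacement (v : L2) (t : ℝ) : Plane := ∫ r in (0 : ℝ)..t, v (r : UnitAddCircle)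

lemma integral_congr_L2 {f g : UnitAddCircle → Plane} (h : f =ᵐ[volume] g) (t : ℝ) :
    ∫ r in (0 : ℝ)..t, f (r : UnitAddCircle) = ∫ r in (0 : ℝ)..t, g (r : UnitAddCircle) := by
  refine intervalIntegral.integral_congr_ae ?_
  filter_upwards [quasi_mk.ae h] with r hr _ using hr

lemma displacement_add (v w : L2) (t : ℝ) :
    displacement (v + w) t = displacement v t + displacement w t := by
  unfold displacement
  rw [integral_congr_L2 (Lp.coeFn_add v w)]
  exact intervalIntegral.integral_add (intervalIntegrable_vel v 0 t) (intervalIntegrable_vel w 0 t)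

lemma displacement_smul (c : ℝ) (v : L2) (t : ℝ) :
    displacement (c • v) t = c • displacement v t := by
  unfold displacement
  rw [integral_congr_L2 (Lp.coeFn_smul c v)]
  exact intervalIntegral.integral_smul c _

lemma displacement_zero (t : ℝ) : displacement 0 t = 0 := by
  simpa using displacement_smul 0 0 t

lemma displacement_neg (v : L2) (t : ℝ) : displacement (-v) t = - displacement v t := by
  simpa using displacement_smul (-1) v t

/-- The space `H¹(𝕋, 𝕋²)`: continuous loops `x` in the torus together with their (uniquely
determined) weak derivative `x' ∈ L²`, so that `x(t) = x(0) + ∫₀ᵗ x'` for all `t`.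
It is a group under pointwise addition, and its topology, inherited from `C⁰ × L²`,
is the `H¹` topology. -/
def h1Loops : AddSubgroup (C(UnitAddCircle, Torus) × L2) where
  carrier := {x | ∀ t : ℝ, x.1 (t : UnitAddCircle) = x.1 0 + proj (displacement x.2 t)}
  add_mem' := by
    intro x y hx hy t
    simp only [Prod.fst_add, Prod.snd_add, ContinuousMap.add_apply, displacement_add, proj_add,
      hx t, hy t]
    abel
  zero_mem' := by intro t; simp [displacement_zero, proj_zero]
  neg_mem' := by
    intro x hx t
    simp only [Prod.fst_neg, Prod.snd_neg, ContinuousMap.neg_apply, displacement_neg, proj_neg,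
      hx t]
    abel

/-- The space `H¹(𝕋, ℝ²)` of `H¹` vector fields along loops: continuous maps `ξ` with weak
derivative `ξ' ∈ L²`. The norm inherited from `C⁰ × L²` is equivalent to the `H¹` norm. -/
def h1Fields : Submodule ℝ (C(UnitAddCircle, Plane) × L2) where
  carrier := {ξ | ∀ t : ℝ, ξ.1 (t : UnitAddCircle) = ξ.1 0 + displacement ξ.2 t}
  add_mem' := by
    intro x y hx hy t
    simp only [Prod.fst_add, Prod.snd_add, ContinuousMap.add_apply, displacement_add, hx t, hy t]
    abel
  zero_mem' := by intro t; simp [displacement_zero]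
  smul_mem' := by
    intro c x hx t
    simp only [Prod.smul_fst, Prod.smul_snd, ContinuousMap.smul_apply, displacement_smul, hx t,
      smul_add]

abbrev H1Loop : Type := h1Loops
abbrev H1Field : Type := h1Fields

/-- The space `𝓜 = H¹(𝕋, 𝕋²) × (0, ∞)` of `H¹` loops with arbitrary period. -/
abbrev Loops : Type := H1Loop × Ioi (0 : ℝ)

/-- The loop `x : 𝕋 → 𝕋²` of `γ = (x, T)`. -/
def Loops.loop (γ : Loops) : C(UnitAddCircle, Torus) := γ.1.1.1

/-- The derivative `x'` of the loop of `γ = (x, T)`. -/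
def Loops.vel (γ : Loops) : L2 := γ.1.1.2

/-- The period `T` of `γ = (x, T)`. -/
def Loops.period (γ : Loops) : ℝ := γ.2.1

/-- The tangent space `H¹(𝕋, ℝ²) × ℝ` of `𝓜`; the tangent bundle of the torus is trivial. -/
abbrev Tangent : Type := H1Field × ℝ

/-- The projection of a vector field along loops to a loop in the torus. -/
def projField (ξ : H1Field) : H1Loop :=
  ⟨(ContinuousMap.comp ⟨proj, continuous_proj⟩ ξ.1.1, ξ.1.2), by
    intro t
    change proj (ξ.1.1 (t : UnitAddCircle)) = proj (ξ.1.1 0) + proj (displacement ξ.1.2 t)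
    rw [ξ.2 t, proj_add]⟩

/-- The chart `(ξ, S) ↦ (x + ξ, T + S)` of `𝓜` centred at `γ = (x, T)`. Only its germ at `0`
is used, so the values for `T + S ≤ 0` are irrelevant. -/
def chart (γ : Loops) (h : Tangent) : Loops :=
  (γ.1 + projField h.1, if hS : 0 < γ.2.1 + h.2 then ⟨γ.2.1 + h.2, hS⟩ else γ.2)

lemma measurePreserving_nsmul (n : ℕ+) :
    MeasurePreserving (fun s : UnitAddCircle => (n : ℕ) • s) volume volume := by
  simpa using MeasureTheory.Measure.measurePreserving_zsmul (volume : Measure UnitAddCircle)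
    (n := ((n : ℕ) : ℤ)) (by exact_mod_cast n.ne_zero)

lemma displacement_iterate (n : ℕ+) (v : L2) (t : ℝ) :
    displacement (((n : ℕ) : ℝ) • Lp.compMeasurePreserving _ (measurePreserving_nsmul n) v) t
      = displacement v (n * t) := by
  rw [displacement_smul]
  unfold displacement
  rw [integral_congr_L2 (Lp.coeFn_compMeasurePreserving v (measurePreserving_nsmul n))]
  have h := intervalIntegral.smul_integral_comp_mul_left (a := 0) (b := t)
    (fun r : ℝ => v (r : UnitAddCircle)) ((n : ℕ) : ℝ)
  rw [mul_zero] at h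
  rw [← h]
  congr 1
  refine intervalIntegral.integral_congr fun r _ => ?_
  simp [Function.comp]

/-- The iterate `γⁿ = (xⁿ, n T)`, where `xⁿ(s) = x(n s)`. -/
def iterate (n : ℕ+) (γ : Loops) : Loops :=
  (⟨(⟨fun s => γ.loop ((n : ℕ) • s), by fun_prop⟩,
      ((n : ℕ) : ℝ) • Lp.compMeasurePreserving _ (measurePreserving_nsmul n) γ.vel), by
    intro t
    change γ.loop ((n : ℕ) • (t : UnitAddCircle)) = γ.loop ((n : ℕ) • 0) + proj (displacement _ t)
    rw [displacement_iterate, smul_zero]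
    have h := γ.1.2 (n * t)
    have h2 : (((n : ℕ) * t : ℝ) : UnitAddCircle) = (n : ℕ) • (t : UnitAddCircle) := by simp
    rw [h2] at h
    exact h⟩,
   ⟨(n : ℕ) * γ.2.1, mem_Ioi.2 (mul_pos (by exact_mod_cast n.pos) (mem_Ioi.1 γ.2.2))⟩)

/-- The orbit `𝕋 · γ` of `γ = (x, T)` under `ψ · (x, T) = (x(ψ + ·), T)`. -/
def orbit (γ : Loops) : Set Loops :=
  {β | ∃ ψ : UnitAddCircle, (∀ s, β.loop s = γ.loop (ψ + s)) ∧ β.period = γ.period}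

/-- `γ` is a contractible loop. -/
def Contractible (γ : Loops) : Prop := γ.loop.Nullhomotopic

/-- Boundedness in `𝓜` (the torus is compact, so only derivatives and periods matter). -/
def BoundedLoops (U : Set Loops) : Prop := ∃ C : ℝ, ∀ γ ∈ U, ‖γ.vel‖ ≤ C ∧ γ.period ≤ C

/-! ### The action 1-form and its primitives -/

/-- The kinetic energy `e(x) = ½ ∫ |x'|²`. -/
def kinetic (g : TorusMetric) (γ : Loops) : ℝ :=
  (1 / 2) * ∫ s : UnitAddCircle, g.val (γ.loop s) (γ.vel s) (γ.vel s)

/-- The functional `𝔸_k(x, T) = e(x) / T + k T`. -/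
def kineticAction (g : TorusMetric) (k : ℝ) (γ : Loops) : ℝ :=
  kinetic g γ / γ.period + k * γ.period

/-- A (not necessarily continuous) 1-form on `𝓜`. -/
abbrev OneForm : Type := Loops → Tangent → ℝ

/-- The transgression `(ξ, S) ↦ ∫ σ_x(ξ, x')` of a 2-form. -/
def transgression (σ : TwoForm) : OneForm := fun γ h =>
  ∫ s : UnitAddCircle, σ.eval (γ.loop s) (h.1.1.1 s) (γ.vel s)

/-- The action 1-form `η_k = d𝔸_k + ∫ σ_x(·, x')`. -/
def actionForm (g : TorusMetric) (σ : TwoForm) (k : ℝ) : OneForm := fun γ h =>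
  fderiv ℝ (fun h' => kineticAction g k (chart γ h')) 0 h + transgression σ γ h

/-- `f` is (Fréchet) differentiable on `W` with `df = η`. -/
def IsPrimitiveOn (η : OneForm) (f : Loops → ℝ) (W : Set Loops) : Prop :=
  ∀ γ ∈ W, ∃ L : Tangent →L[ℝ] ℝ,
    HasFDerivAt (fun h => f (chart γ h)) L 0 ∧ ∀ h, L h = η γ h

/-- `F(s) = ∫₀ˢ u^* η` for a closed 1-form `η` and a continuous path `u`: `F` starts at `0`, and
near every parameter its increments are those of a local primitive of `η` along `u`.
As `η` is closed, there is exactly one such `F`. -/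
def IsIntegralAlong (η : OneForm) (u : C(unitInterval, Loops)) (F : unitInterval → ℝ) : Prop :=
  F 0 = 0 ∧ ∀ s₀ : unitInterval, ∃ (W : Set Loops) (f : Loops → ℝ),
    IsOpen W ∧ u s₀ ∈ W ∧ IsPrimitiveOn η f W ∧
      ∀ᶠ s in 𝓝 s₀, F s - F s₀ = f (u s) - f (u s₀)

/-- The open set `𝓥` of loops which avoid the point `q₀`. -/
def avoiding (q₀ : Torus) : Set Loops := {γ | ∀ s, γ.loop s ≠ q₀}

/-- The free-period action functional `T ∫ (½ |x'/T|² + θ_x(x'/T) + k)`, which is used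
on the set of loops avoiding the point where `θ` is not defined. -/
def freeAction (g : TorusMetric) (θ : Torus → Plane →L[ℝ] ℝ) (k : ℝ) (γ : Loops) : ℝ :=
  γ.period * ∫ s : UnitAddCircle,
    ((1 / 2) * g.val (γ.loop s) (γ.period⁻¹ • γ.vel s) (γ.period⁻¹ • γ.vel s)
      + θ (γ.loop s) (γ.period⁻¹ • γ.vel s) + k)

/-- `α` is a strict local minimizer of the action with energy `k`; `θ` is a primitive of `σ`
away from a point `q₀` which does not lie on `α`. -/
def IsStrictLocalMinimizer (g : TorusMetric) (q₀ : Torus) (θ : Torus → Plane →L[ℝ] ℝ) (k : ℝ)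
    (α : Loops) : Prop :=
  ∃ U : Set Loops, IsOpen U ∧ orbit α ⊆ U ∧ U ⊆ avoiding q₀ ∧
    (∀ γ ∈ U, freeAction g θ k α ≤ freeAction g θ k γ) ∧
    ∀ γ ∈ U \ orbit α, freeAction g θ k α < freeAction g θ k γ

/-- `U` is a bounded open neighbourhood of `𝕋 · α`, contained with its boundary in the domain
of the action functional, and `inf_{∂U} 𝕊_k > 𝕊_k(α)`. -/
structure IsMinimizerNeighborhood (g : TorusMetric) (q₀ : Torus) (θ : Torus → Plane →L[ℝ] ℝ) (k : ℝ)
    (α : Loops) (U : Set Loops) : Prop where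
  isOpen : IsOpen U
  orbit_subset : orbit α ⊆ U
  closure_subset : closure U ⊆ avoiding q₀
  bounded : BoundedLoops U
  lt_boundary : ∃ c : ℝ, freeAction g θ k α < c ∧ ∀ γ ∈ frontier U, c ≤ freeAction g θ k γ

/-- `M_k`: the closure of the set of the local minimizers of `𝕊_k` in `U`. -/
def minimizers (g : TorusMetric) (θ : Torus → Plane →L[ℝ] ℝ) (U : Set Loops) (k : ℝ) : Set Loops :=
  closure {β | β ∈ U ∧ IsLocalMin (freeAction g θ k) β}

/-- The interval of energies on which the minimax values are defined: an open interval `I` of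
positive numbers around `kstar` such that `M_k` is non-empty and compact for `k ∈ I`, and
such that for `k₋ < k₊` in `I` every point `β` of `M_{k₊}` can be joined to `M_{k₋}` by a path
in `U` on which `𝕊_{k₋}` is at most `𝕊_{k₋}(β)`. -/
structure IsMinimaxInterval (g : TorusMetric) (θ : Torus → Plane →L[ℝ] ℝ) (U : Set Loops)
    (kstar : ℝ) (I : Set ℝ) : Prop where
  isOpen : IsOpen I
  ordConnected : I.OrdConnected
  mem : kstar ∈ I
  pos : I ⊆ Ioi 0
  nonempty : ∀ k ∈ I, (minimizers g θ U k).Nonempty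
  compact : ∀ k ∈ I, IsCompact (minimizers g θ U k)
  connect : ∀ km ∈ I, ∀ kp ∈ I, km < kp → ∀ β ∈ minimizers g θ U kp,
    ∃ w : C(unitInterval, Loops), (∀ s, w s ∈ U) ∧ w 0 ∈ minimizers g θ U km ∧ w 1 = β ∧
      ∀ s, freeAction g θ km (w s) ≤ freeAction g θ km β

/-! ### The minimax values -/

/-- `𝓟_n(k)`: the closed continuous paths in the component of `αⁿ`, based at an `n`-th iterate
of an element of `M_k`, over which the integral of the transgression of `dq¹ ∧ dq²`
does not vanish. -/
def minimaxClass (g : TorusMetric) (θ : Torus → Plane →L[ℝ] ℝ) (α : Loops) (U : Set Loops)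
    (n : ℕ+) (k : ℝ) : Set C(unitInterval, Loops) :=
  {u | (∀ s, u s ∈ connectedComponent (iterate n α)) ∧ u 0 = u 1 ∧
    u 0 ∈ iterate n '' minimizers g θ U k ∧
    ∃ G, IsIntegralAlong (transgression stdArea) u G ∧ G 1 ≠ 0}

/-- `𝕊_k(u, s) = 𝕊_k(u(0)) + ∫₀ˢ u^* η_k`, where `F` is the integral of `η_k` along `u`. -/
def actionAlong (g : TorusMetric) (θ : Torus → Plane →L[ℝ] ℝ) (k : ℝ) (u : C(unitInterval, Loops))
    (F : unitInterval → ℝ) (s : unitInterval) : ℝ :=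
  freeAction g θ k (u 0) + F s

/-- The minimax value `c_n(k) = inf_{u ∈ 𝓟_n(k)} max_s 𝕊_k(u, s)`, as an extended real number,
so that no convention about infima of reals enters. The inner infimum ranges over the one
integral `F` of `η_k` along `u`. -/
def minimaxValue (g : TorusMetric) (σ : TwoForm) (θ : Torus → Plane →L[ℝ] ℝ) (α : Loops)
    (U : Set Loops) (n : ℕ+) (k : ℝ) : EReal :=
  ⨅ u ∈ minimaxClass g θ α U n k, ⨅ F, ⨅ _ : IsIntegralAlong (actionForm g σ k) u F,
    ⨆ s : unitInterval, ((actionAlong g θ k u F s : ℝ) : EReal)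

end MagneticTorus

end

noncomputable section

namespace MagneticTorus

/-! ### The fundamental theorem of calculus along primitives of integrable functions -/

/-! Let `u` be a path of the class at the higher energy `kp`, based at `β^n`. The connecting
hypothesis gives a path `w` from the minimizers at the lower energy `km` to `β`, along which the
action at `km` never exceeds its value at `β`. Conjugate `u` by the iterated path `p = w^n`: first
`p`, then `u`, then `p` reversed. The new path has its base point in the right set, stays in the
same component, and has the same integral of the area transgression, since the two contributions of
`p` cancel.

Its action at `km` stays below the maximum of the action of `u` at `kp`. Along `p` this holds
because the action is multiplied by `n` under iteration (`freeAction_iterate`) and increases with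
the energy. Along `u` the two actions differ by `(kp - km) * T > 0`. On the way back the action of
`p` is shifted by the integral over `u`, which is the same at both energies because `u` closes up
and so begins and ends with the same period. This is `exists_mem_minimaxClass_le`.

The remaining work justifies the calculus of integrals along paths. The free action must be a
primitive of `actionForm` on the loops avoiding `q₀` (`isPrimitiveOn_freeAction`), and the area
transgression must have local primitives everywhere (`exists_isPrimitiveOn_transgression_stdArea`).
Both rest on integration by parts along `H¹` curves. Integrals can be concatenated because two
primitives differ by a locally constant function (`IsPrimitiveOn.eventually_sub_eq`). -/

lemma absolutelyContinuousOnInterval_of_dist_le {X Y : Type*} [PseudoMetricSpace X]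
    [PseudoMetricSpace Y] {f : ℝ → X} {g : ℝ → Y} {a b K : ℝ}
    (hg : AbsolutelyContinuousOnInterval g a b)
    (h : ∀ s ∈ uIcc a b, ∀ t ∈ uIcc a b, dist (f s) (f t) ≤ K * dist (g s) (g t)) :
    AbsolutelyContinuousOnInterval f a b := by
  unfold AbsolutelyContinuousOnInterval at hg ⊢
  have hg' := hg.const_mul K
  rw [mul_zero] at hg'
  refine squeeze_zero' (Eventually.of_forall fun E => Finset.sum_nonneg fun _ _ => dist_nonneg)
    ?_ hg'
  refine eventually_inf_principal.2 (Eventually.of_forall fun E hE => ?_)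
  rw [Finset.mul_sum]
  exact Finset.sum_le_sum fun i hi => h _ (hE.1 i hi).1 _ (hE.1 i hi).2

/-- The chain rule and the fundamental theorem of calculus along a curve with integrable
derivative. -/
theorem integral_fderiv_comp_primitive {V : Type*} [NormedAddCommGroup V] [NormedSpace ℝ V]
    [CompleteSpace V] {v y : ℝ → V} (hv : ∀ a b, IntervalIntegrable v volume a b)
    (hy : ∀ t, y t = y 0 + ∫ r in (0 : ℝ)..t, v r) {Ψ : V → ℝ}
    (hΨ : ∀ t ∈ Icc (0 : ℝ) 1, ContDiffAt ℝ 1 Ψ (y t)) :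
    ∫ t in (0 : ℝ)..1, fderiv ℝ Ψ (y t) (v t) = Ψ (y 1) - Ψ (y 0) := by
  have hycont : Continuous y := by
    rw [show y = fun t => y 0 + ∫ r in (0 : ℝ)..t, v r from funext hy]
    exact continuous_const.add (intervalIntegral.continuous_primitive hv 0)
  have hK : IsCompact (y '' Icc 0 1) := isCompact_Icc.image hycont
  -- `C¹` gives only local Lipschitz bounds; compactness of the curve turns them into one constant.
  -- Then `Ψ ∘ y` varies by at most `K` times the increments of `∫ ‖v‖`, hence is absolutely
  -- continuous.
  obtain ⟨K, hKlip⟩ : ∃ K, LipschitzOnWith K Ψ (y '' Icc 0 1) := by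
    refine LocallyLipschitzOn.exists_lipschitzOnWith_of_compact hK ?_
    rintro _ ⟨t, ht, rfl⟩
    obtain ⟨K, s, hs, h⟩ := (hΨ t ht).exists_lipschitzOnWith
    exact ⟨K, s, mem_nhdsWithin_of_mem_nhds hs, h⟩
  have hac : AbsolutelyContinuousOnInterval (fun t => ∫ r in (0 : ℝ)..t, ‖v r‖) 0 1 :=
    (hv 0 1).norm.absolutelyContinuousOnInterval_intervalIntegral (by simp)
  have hΨac : AbsolutelyContinuousOnInterval (fun t => Ψ (y t)) 0 1 := by
    refine absolutelyContinuousOnInterval_of_dist_le (K := K) hac fun s hs t ht => ?_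
    rw [uIcc_of_le zero_le_one] at hs ht
    refine (hKlip.dist_le_mul _ ⟨s, hs, rfl⟩ _ ⟨t, ht, rfl⟩).trans ?_
    refine mul_le_mul_of_nonneg_left ?_ K.2
    rw [dist_eq_norm, dist_eq_norm, hy s, hy t, add_sub_add_left_eq_sub,
      intervalIntegral.integral_interval_sub_left (hv _ _) (hv _ _),
      intervalIntegral.integral_interval_sub_left (hv _ _).norm (hv _ _).norm]
    exact intervalIntegral.norm_integral_le_abs_integral_norm
  rw [← hΨac.integral_deriv_eq_sub]
  refine intervalIntegral.integral_congr_ae ?_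
  filter_upwards [(hv 0 1).ae_hasDerivAt_integral] with t ht ht'
  rw [uIoc_of_le zero_le_one] at ht'
  have ht2 : t ∈ Icc (0 : ℝ) 1 := Ioc_subset_Icc_self ht'
  have h1 : HasDerivAt y (v t) t := by
    rw [show y = fun t => y 0 + ∫ r in (0 : ℝ)..t, v r from funext hy]
    exact (ht (by rwa [uIcc_of_le zero_le_one]) 0 (by simp)).const_add _
  have h2 := ((hΨ t ht2).differentiableAt (by norm_num)).hasFDerivAt.comp_hasDerivAt t h1
  exact h2.deriv.symm

/-! ### Superposition operators on spaces of continuous functions -/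

/-- Strict differentiability at `p` and continuity of the derivative bound the remainder at all base
points near `p`; compactness of `K` makes the bound uniform. -/
lemma eventually_forall_norm_sub_fderiv_le_of_isCompact {V E : Type*} [NormedAddCommGroup V]
    [NormedSpace ℝ V] [NormedAddCommGroup E] [NormedSpace ℝ E] {K : Set V} (hK : IsCompact K)
    {f : V → E} (hf : ∀ p ∈ K, ContDiffAt ℝ 1 f p) {ε : ℝ} (hε : 0 < ε) :
    ∀ᶠ z in 𝓝 (0 : V), ∀ p ∈ K, ‖f (p + z) - f p - fderiv ℝ f p z‖ ≤ ε * ‖z‖ := by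
  refine hK.eventually_forall_of_forall_eventually fun p hp => ?_
  have h1 := (hf p hp).hasStrictFDerivAt (by norm_num)
  have h2 := h1.isLittleO.def (half_pos hε)
  have h3 : ∀ᶠ q in 𝓝 p, ‖fderiv ℝ f q - fderiv ℝ f p‖ < ε / 2 := by
    have := ((hf p hp).fderiv_right (m := 0) (by norm_num)).continuousAt
    have := Metric.tendsto_nhds.1 this (ε / 2) (half_pos hε)
    simpa only [dist_eq_norm] using this
  have hc : Tendsto (fun z : V × V => (z.2 + z.1, z.2)) (𝓝 (0, p)) (𝓝 (p, p)) := by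
    have : Continuous (fun z : V × V => (z.2 + z.1, z.2)) := by fun_prop
    simpa using this.tendsto (0, p)
  have hc2 : Tendsto (fun z : V × V => z.2) (𝓝 (0, p)) (𝓝 p) :=
    continuous_snd.tendsto (0, p)
  filter_upwards [hc.eventually h2, hc2.eventually h3] with z h4 h5
  simp only [add_sub_cancel_left] at h4
  have h6 : ‖(fderiv ℝ f z.2 - fderiv ℝ f p) z.1‖ ≤ ε / 2 * ‖z.1‖ :=
    (ContinuousLinearMap.le_opNorm _ _).trans
      (mul_le_mul_of_nonneg_right h5.le (norm_nonneg _))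
  calc ‖f (z.2 + z.1) - f z.2 - fderiv ℝ f z.2 z.1‖
      = ‖(f (z.2 + z.1) - f z.2 - fderiv ℝ f p z.1) - (fderiv ℝ f z.2 - fderiv ℝ f p) z.1‖ := by
        congr 1; simp
    _ ≤ ε / 2 * ‖z.1‖ + ε / 2 * ‖z.1‖ := (norm_sub_le _ _).trans (add_le_add h4 h6)
    _ = ε * ‖z.1‖ := by ring

section Superposition

variable {X V E : Type*} [TopologicalSpace X] [CompactSpace X] [NormedAddCommGroup V]
  [NormedSpace ℝ V] [NormedAddCommGroup E] [NormedSpace ℝ E]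

/-- Pointwise application of a continuous family of operators to continuous functions. -/
def pointwiseApply (D : C(X, V →L[ℝ] E)) : C(X, V) →L[ℝ] C(X, E) :=
  LinearMap.mkContinuous
    { toFun := fun ξ => ⟨fun s => D s (ξ s), by fun_prop⟩
      map_add' := fun ξ ζ => by ext s; simp
      map_smul' := fun c ξ => by ext s; simp } ‖D‖ fun ξ => by
    refine (ContinuousMap.norm_le _ (by positivity)).2 fun s => ?_
    exact (ContinuousLinearMap.le_opNorm _ _).trans
      (mul_le_mul (D.norm_coe_le_norm s) (ξ.norm_coe_le_norm s) (norm_nonneg _)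
        ((norm_nonneg _).trans (D.norm_coe_le_norm s)))

@[simp] lemma pointwiseApply_apply (D : C(X, V →L[ℝ] E)) (ξ : C(X, V)) (s : X) :
    pointwiseApply D ξ s = D s (ξ s) := rfl

/-- In the sup norm, a remainder bound uniform in `s` is a Fréchet remainder bound. Only the germ of
`N` at `0` matters, so its default values elsewhere do no harm. -/
lemma hasFDerivAt_pointwiseApply {N : C(X, V) → C(X, E)} {B : X → V → E} {D : C(X, V →L[ℝ] E)}
    (hN : ∀ᶠ ξ in 𝓝 (0 : C(X, V)), ∀ s, N ξ s = B s (ξ s))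
    (hB : ∀ ε > 0, ∀ᶠ z in 𝓝 (0 : V), ∀ s, ‖B s z - B s 0 - D s z‖ ≤ ε * ‖z‖) :
    HasFDerivAt N (pointwiseApply D) 0 := by
  refine HasFDerivAt.of_isLittleO (Asymptotics.IsLittleO.of_bound fun ε hε => ?_)
  obtain ⟨δ, hδ, h⟩ := Metric.eventually_nhds_iff.1 (hB ε hε)
  filter_upwards [hN, Metric.ball_mem_nhds (0 : C(X, V)) hδ] with ξ h1 h2
  refine (ContinuousMap.norm_le _ (by positivity)).2 fun s => ?_
  have h3 : ‖ξ s‖ ≤ ‖ξ‖ := ξ.norm_coe_le_norm s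
  have h4 := h (y := ξ s) (by simpa using h3.trans_lt (by simpa using h2)) s
  have h0 := hN.self_of_nhds s
  simp only [ContinuousMap.sub_apply, h1 s, h0, ContinuousMap.zero_apply, sub_zero,
    pointwiseApply_apply]
  exact h4.trans (mul_le_mul_of_nonneg_left h3 hε.le)

end Superposition

/-! ### Differentiation on the torus -/

lemma proj_surjective : Function.Surjective proj := by
  intro q
  choose r hr using fun i => QuotientAddGroup.mk_surjective (q i)
  exact ⟨WithLp.toLp 2 r, funext hr⟩

lemma isOpenMap_proj : IsOpenMap proj := by
  have h1 : IsOpenMap (fun (r : Fin 2 → ℝ) i => ((r i : ℝ) : UnitAddCircle)) :=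
    IsOpenMap.piMap (fun i => QuotientAddGroup.isOpenMap_coe) (by simp)
  exact h1.comp (PiLp.homeomorph 2 (fun _ : Fin 2 => ℝ)).isOpenMap

lemma map_proj_nhds (p : Plane) : map proj (𝓝 p) = 𝓝 (proj p) :=
  le_antisymm (continuous_proj.tendsto p) (isOpenMap_proj.nhds_le p)

lemma continuousAt_of_comp_proj {E : Type*} [TopologicalSpace E] {A : Torus → E} {p : Plane}
    (h : ContinuousAt (fun p => A (proj p)) p) : ContinuousAt A (proj p) := by
  rw [ContinuousAt, ← map_proj_nhds, tendsto_map'_iff]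
  exact h

/-- Lifts in a fixed compact cube let compactness in the plane give estimates uniform over the
torus. -/
lemma exists_mem_cube_proj_eq (q : Torus) :
    ∃ p : Plane, (∀ i, p i ∈ Icc (0 : ℝ) 1) ∧ proj p = q := by
  obtain ⟨p, rfl⟩ := proj_surjective q
  refine ⟨WithLp.toLp 2 fun i => Int.fract (p i),
    fun i => ⟨Int.fract_nonneg _, (Int.fract_lt_one _).le⟩, ?_⟩
  ext i
  change ((Int.fract (p i) : ℝ) : UnitAddCircle) = ((p i : ℝ) : UnitAddCircle)
  rw [Int.fract, AddCircle.coe_sub]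
  simp

lemma isCompact_cube : IsCompact {p : Plane | ∀ i, p i ∈ Icc (0 : ℝ) 1} := by
  have h : IsCompact (Set.pi univ fun _ : Fin 2 => Icc (0 : ℝ) 1) :=
    isCompact_univ_pi fun _ => isCompact_Icc
  convert! h.image (PiLp.homeomorph 2 (fun _ : Fin 2 => ℝ)).symm.continuous using 1
  ext p
  constructor
  · intro hp
    exact ⟨fun i => p i, fun i _ => hp i, rfl⟩
  · rintro ⟨r, hr, rfl⟩ i
    exact hr i (mem_univ _)

section TorusDeriv

variable {E : Type*} [NormedAddCommGroup E] [NormedSpace ℝ E]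

/-- The derivative of a function on the torus, in the Cartesian frame. -/
def torusDeriv (A : Torus → E) (q : Torus) : Plane →L[ℝ] E :=
  fderiv ℝ (fun p => A (proj p)) (Function.surjInv proj_surjective q)

/-- The lifted function is invariant under deck translations, so the lift chosen in `torusDeriv` is
irrelevant. -/
lemma torusDeriv_proj (A : Torus → E) (p : Plane) :
    torusDeriv A (proj p) = fderiv ℝ (fun p => A (proj p)) p := by
  set p' := Function.surjInv proj_surjective (proj p) with hp'
  have h : proj p' = proj p := Function.surjInv_eq _ _
  have h0 : proj (p' - p) = 0 := by rw [sub_eq_add_neg, proj_add, proj_neg, h, add_neg_cancel]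
  have h2 : (fun z => A (proj z)) = fun z => A (proj (z + (p' - p))) := by
    ext z; rw [proj_add, h0, add_zero]
  change fderiv ℝ _ p' = _
  have h3 := fderiv_comp_add_right (𝕜 := ℝ) (f := fun z => A (proj z)) (x := p) (p' - p)
  rw [← h2, add_sub_cancel] at h3
  exact h3.symm

/-- The superposition operator `ξ ↦ A (x + ξ)`. -/
def superposition (A : Torus → E) (x : C(UnitAddCircle, Torus)) (ξ : C(UnitAddCircle, Plane)) :
    C(UnitAddCircle, E) :=
  open Classical in
  -- The value `0` is a default, not taken for small `ξ` when `x` stays in an open set where `A` is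
  -- smooth.
  if h : Continuous fun s => A (x s + proj (ξ s)) then ⟨_, h⟩ else 0

variable {A : Torus → E} {O : Set Torus} {x : C(UnitAddCircle, Torus)}

lemma contDiffAt_comp_proj (hA : ContDiffOn ℝ ∞ (fun p => A (proj p)) {p | proj p ∈ O})
    (hO : IsOpen O) {p : Plane} (hp : proj p ∈ O) : ContDiffAt ℝ ∞ (fun p => A (proj p)) p :=
  hA.contDiffAt ((hO.preimage continuous_proj).mem_nhds hp)

lemma continuousAt_of_contDiffOn (hA : ContDiffOn ℝ ∞ (fun p => A (proj p)) {p | proj p ∈ O})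
    (hO : IsOpen O) {q : Torus} (hq : q ∈ O) : ContinuousAt A q := by
  obtain ⟨p, rfl⟩ := proj_surjective q
  exact continuousAt_of_comp_proj (contDiffAt_comp_proj hA hO hq).continuousAt

lemma continuousAt_torusDeriv (hA : ContDiffOn ℝ ∞ (fun p => A (proj p)) {p | proj p ∈ O})
    (hO : IsOpen O) {q : Torus} (hq : q ∈ O) : ContinuousAt (torusDeriv A) q := by
  obtain ⟨p, rfl⟩ := proj_surjective q
  refine continuousAt_of_comp_proj ?_
  simp only [torusDeriv_proj]
  exact ((contDiffAt_comp_proj hA hO hq).fderiv_right (m := 0) (by norm_num)).continuousAt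

/-- The derivative of `A` along the loop `x`. -/
def derivAlong (hA : ContDiffOn ℝ ∞ (fun p => A (proj p)) {p | proj p ∈ O})
    (hO : IsOpen O) (hx : ∀ s, x s ∈ O) : C(UnitAddCircle, Plane →L[ℝ] E) where
  toFun s := torusDeriv A (x s)
  continuous_toFun := continuous_iff_continuousAt.2 fun s =>
    (continuousAt_torusDeriv hA hO (hx s)).comp x.continuous.continuousAt

lemma eventually_add_proj_mem (hO : IsOpen O) (hx : ∀ s, x s ∈ O) :
    ∀ᶠ ξ in 𝓝 (0 : C(UnitAddCircle, Plane)), ∀ s, x s + proj (ξ s) ∈ O := by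
  have hc : Continuous fun ξ : C(UnitAddCircle, Plane) =>
      x + ContinuousMap.comp ⟨proj, continuous_proj⟩ ξ :=
    continuous_const.add (ContinuousMap.continuous_postcomp _)
  have h := ContinuousMap.isOpen_setOfPred_mapsTo (Y := Torus) (isCompact_univ (X := UnitAddCircle)) hO
  have h2 := (h.preimage hc).mem_nhds (x := 0) (by
    intro s _
    simpa [proj_zero] using hx s)
  filter_upwards [h2] with ξ hξ s
  exact hξ (mem_univ s)

lemma eventually_superposition_apply (hA : ContDiffOn ℝ ∞ (fun p => A (proj p)) {p | proj p ∈ O})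
    (hO : IsOpen O) (hx : ∀ s, x s ∈ O) :
    ∀ᶠ ξ in 𝓝 (0 : C(UnitAddCircle, Plane)), ∀ s, superposition A x ξ s = A (x s + proj (ξ s)) := by
  filter_upwards [eventually_add_proj_mem hO hx] with ξ hξ s
  have h : Continuous fun s => A (x s + proj (ξ s)) :=
    continuous_iff_continuousAt.2 fun s =>
      (continuousAt_of_contDiffOn hA hO (hξ s)).comp (f := fun s => x s + proj (ξ s))
        (x.continuous.add (continuous_proj.comp ξ.continuous)).continuousAt
  simp [superposition, h]

theorem hasFDerivAt_superposition (hA : ContDiffOn ℝ ∞ (fun p => A (proj p)) {p | proj p ∈ O})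
    (hO : IsOpen O) (hx : ∀ s, x s ∈ O) :
    HasFDerivAt (superposition A x) (pointwiseApply (derivAlong hA hO hx)) 0 := by
  refine hasFDerivAt_pointwiseApply (B := fun s z => A (x s + proj z))
    (eventually_superposition_apply hA hO hx) fun ε hε => ?_
  -- The lifts in the unit cube of the points of the loop: a compact set on which the Taylor
  -- estimate is uniform.
  have hK : IsCompact ({p : Plane | ∀ i, p i ∈ Icc (0 : ℝ) 1} ∩ proj ⁻¹' range x) :=
    isCompact_cube.inter_right ((isCompact_range x.continuous).isClosed.preimage continuous_proj)
  have := eventually_forall_norm_sub_fderiv_le_of_isCompact hK (f := fun p => A (proj p))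
    (fun p hp => by
      obtain ⟨s, hs⟩ := hp.2
      exact (contDiffAt_comp_proj hA hO (hs ▸ hx s)).of_le (by norm_num)) hε
  filter_upwards [this] with z hz s
  obtain ⟨p, hp, hps⟩ := exists_mem_cube_proj_eq (x s)
  have h := hz p ⟨hp, s, hps.symm⟩
  rw [proj_add, ← torusDeriv_proj, hps] at h
  have h0 : x s + proj 0 = x s := by rw [proj_zero, add_zero]
  change ‖A (x s + proj z) - A (x s + proj 0) - torusDeriv A (x s) z‖ ≤ ε * ‖z‖
  rwa [h0]

end TorusDeriv

/-! ### Charts of the loop space -/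

lemma eq_zero_of_proj_eq_zero {p : Plane} (h : proj p = 0) (hp : ‖p‖ < 1) : p = 0 := by
  ext i
  have hi : ((p i : ℝ) : UnitAddCircle) = 0 := congrFun h i
  obtain ⟨n, hn⟩ := (AddCircle.coe_eq_zero_iff 1).1 hi
  have h1 : |p i| < 1 := (PiLp.norm_apply_le p i).trans_lt hp
  rw [zsmul_eq_mul, mul_one] at hn
  rw [← hn] at h1 ⊢
  have : n = 0 := by
    rw [← Int.abs_lt_one_iff]
    have h2 : ((|n| : ℤ) : ℝ) < ((1 : ℤ) : ℝ) := by simpa using h1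
    exact Int.cast_lt.1 h2
  simp [this]

instance : IsProbabilityMeasure (volume : Measure UnitAddCircle) :=
  ⟨UnitAddCircle.measure_univ⟩

/-- The circle has total measure one, so the `L¹` norm is at most the `L²` norm. -/
lemma integral_norm_le (v : L2) : ∫ s : UnitAddCircle, ‖v s‖ ≤ ‖v‖ := by
  have h1 : eLpNorm v 1 volume ≤ eLpNorm v 2 volume :=
    eLpNorm_le_eLpNorm_of_exponent_le (by norm_num) (Lp.aestronglyMeasurable v)
  rw [Lp.norm_def, integral_norm_eq_lintegral_enorm (Lp.aestronglyMeasurable v),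
    ← eLpNorm_one_eq_lintegral_enorm]
  exact ENNReal.toReal_mono (Lp.eLpNorm_ne_top v) h1

lemma norm_displacement_le (v : L2) {t : ℝ} (ht : t ∈ Icc (0 : ℝ) 1) :
    ‖displacement v t‖ ≤ ‖v‖ := by
  refine (intervalIntegral.norm_integral_le_integral_norm ht.1).trans ?_
  refine le_trans ?_ (integral_norm_le v)
  rw [← UnitAddCircle.intervalIntegral_preimage 0 (fun s => ‖v s‖), zero_add]
  exact intervalIntegral.integral_mono_interval le_rfl ht.1 ht.2
    (Eventually.of_forall fun _ => norm_nonneg _) (intervalIntegrable_vel v 0 1).norm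

lemma displacement_add_one (v : L2) (t : ℝ) :
    displacement v (t + 1) = displacement v t + displacement v 1 := by
  have hper : Function.Periodic (fun r : ℝ => v (r : UnitAddCircle)) 1 := by intro r; simp
  unfold displacement
  rw [← intervalIntegral.integral_add_adjacent_intervals (intervalIntegrable_vel v 0 t)
    (intervalIntegrable_vel v t (t + 1)), hper.intervalIntegral_add_eq t 0, zero_add]

lemma continuous_displacement (v : L2) : Continuous (displacement v) :=
  intervalIntegral.continuous_primitive (intervalIntegrable_vel v) 0

lemma exists_coe_eq (s : UnitAddCircle) : ∃ t ∈ Icc (0 : ℝ) 1, (t : UnitAddCircle) = s := by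
  obtain ⟨t, rfl⟩ := QuotientAddGroup.mk_surjective s
  refine ⟨Int.fract t, ⟨Int.fract_nonneg _, (Int.fract_lt_one _).le⟩, ?_⟩
  rw [Int.fract, AddCircle.coe_sub]
  simp

/-- Local surjectivity of the chart: a loop near the constant loop `0` lifts to a closed small
field, obtained by integrating its velocity from a small lift of its base point. -/
lemma eventually_exists_projField_eq {ε : ℝ} (hε : 0 < ε) :
    ∀ᶠ y in 𝓝 (0 : H1Loop), ∃ ξ : H1Field, ‖ξ‖ < ε ∧ projField ξ = y := by
  have hc1 : Continuous fun y : H1Loop => y.1.2 := continuous_snd.comp continuous_subtype_val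
  have hc2 : Continuous fun y : H1Loop => y.1.1 0 :=
    (ContinuousEvalConst.continuous_eval_const 0).comp (continuous_fst.comp continuous_subtype_val)
  have h1 : ∀ᶠ y in 𝓝 (0 : H1Loop), ‖y.1.2‖ < min (ε / 3) 1 := by
    have := hc1.norm.tendsto 0
    refine this.eventually (gt_mem_nhds ?_)
    simp [hε]
  have h2 : ∀ᶠ y in 𝓝 (0 : H1Loop), y.1.1 0 ∈ proj '' Metric.ball 0 (ε / 3) := by
    refine hc2.tendsto 0 |>.eventually ?_
    have : proj '' Metric.ball 0 (ε / 3) ∈ 𝓝 (proj 0) :=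
      isOpenMap_proj.image_mem_nhds (Metric.ball_mem_nhds _ (by positivity))
    rw [proj_zero] at this
    exact this
  filter_upwards [h1, h2] with y h1 ⟨r, hr, hry⟩
  -- The total displacement is an integer vector of norm less than one, so the lift closes up.
  have hd1 : displacement y.1.2 1 = 0 := by
    refine eq_zero_of_proj_eq_zero ?_
      ((norm_displacement_le _ ⟨zero_le_one, le_rfl⟩).trans_lt (h1.trans_le (min_le_right _ _)))
    have := y.2 1
    rw [AddCircle.coe_period] at this
    simpa using this
  have hper : Function.Periodic (fun t => r + displacement y.1.2 t) 1 := by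
    intro t
    simp only [displacement_add_one, hd1, add_zero]
  let ξ₀ : C(UnitAddCircle, Plane) :=
    ⟨hper.lift, continuous_coinduced_dom.2 (continuous_const.add (continuous_displacement _))⟩
  have hξ₀ : ∀ t : ℝ, ξ₀ (t : UnitAddCircle) = r + displacement y.1.2 t := fun t => rfl
  have hξ₁ : ξ₀ 0 = r := by
    have := hξ₀ 0
    simpa [displacement] using this
  refine ⟨⟨(ξ₀, y.1.2), fun t => by rw [hξ₀, hξ₁]⟩, ?_, ?_⟩
  · refine max_lt ?_ ((h1.trans_le (min_le_left _ _)).trans (by linarith))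
    refine (ContinuousMap.norm_lt_iff _ hε).2 fun s => ?_
    obtain ⟨t, ht, rfl⟩ := exists_coe_eq s
    change ‖ξ₀ t‖ < ε
    rw [hξ₀]
    have h3 := norm_displacement_le y.1.2 ht
    have h4 : ‖r‖ < ε / 3 := by simpa using hr
    have h5 := h1.trans_le (min_le_left _ _)
    linarith [norm_add_le r (displacement y.1.2 t)]
  · refine Subtype.ext (Prod.ext ?_ rfl)
    ext1 s
    obtain ⟨t, ht, rfl⟩ := exists_coe_eq s
    rw [y.2 t, ← hry, ← proj_add, ← hξ₀]
    rfl

lemma projField_add (ξ ζ : H1Field) : projField (ξ + ζ) = projField ξ + projField ζ := by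
  refine Subtype.ext (Prod.ext ?_ rfl)
  ext1 s
  exact proj_add _ _

lemma projField_zero : projField 0 = 0 := by
  refine Subtype.ext (Prod.ext ?_ rfl)
  ext1 s
  exact proj_zero

lemma continuous_projField : Continuous projField := by
  refine Continuous.subtype_mk (Continuous.prodMk ?_ ?_) _
  · exact (ContinuousMap.continuous_postcomp _).comp (continuous_fst.comp continuous_subtype_val)
  · exact continuous_snd.comp continuous_subtype_val

lemma projField_injOn {ξ ζ : H1Field} (hξ : ‖ξ‖ < 1 / 2) (hζ : ‖ζ‖ < 1 / 2)
    (h : projField ξ = projField ζ) : ξ = ζ := by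
  refine Subtype.ext (Prod.ext ?_ ?_)
  · ext1 s
    have h1 : proj (ξ.1.1 s) = proj (ζ.1.1 s) :=
      congrFun (congrArg (fun y : H1Loop => (y.1.1 : UnitAddCircle → Torus)) h) s
    rw [← sub_eq_zero]
    refine eq_zero_of_proj_eq_zero ?_ ?_
    · rw [sub_eq_add_neg, proj_add, proj_neg, h1, add_neg_cancel]
    · have h2 : ‖ξ.1.1 s‖ ≤ ‖ξ‖ := (ξ.1.1.norm_coe_le_norm s).trans (le_max_left _ _)
      have h3 : ‖ζ.1.1 s‖ ≤ ‖ζ‖ := (ζ.1.1.norm_coe_le_norm s).trans (le_max_left _ _)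
      linarith [norm_sub_le (ξ.1.1 s) (ζ.1.1 s)]
  · exact congrArg (fun y : H1Loop => y.1.2) h

lemma chart_zero (γ : Loops) : chart γ 0 = γ := by
  have h : 0 < γ.2.1 := γ.2.2
  refine Prod.ext ?_ (Subtype.ext ?_)
  · simp [chart, projField_zero]
  · simp [chart]

lemma chart_snd {γ : Loops} {h : Tangent} (hh : 0 < γ.2.1 + h.2) :
    ((chart γ h).2 : ℝ) = γ.2.1 + h.2 := by
  simp [chart, hh]

/-- Changes of chart are translations, so a derivative at the origin of one chart can be read at any
point of another. -/
lemma chart_chart {γ : Loops} {h h' : Tangent} (hh : 0 < γ.2.1 + h.2)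
    (hh' : 0 < γ.2.1 + h.2 + h'.2) : chart (chart γ h) h' = chart γ (h + h') := by
  refine Prod.ext ?_ (Subtype.ext ?_)
  · simp only [chart, Prod.fst_add, projField_add, add_assoc]
  · rw [chart_snd (by rwa [chart_snd hh]), chart_snd hh, chart_snd (by simpa [← add_assoc] using hh')]
    simp [add_assoc]

lemma period_pos (γ : Loops) : 0 < γ.2.1 := γ.2.2

lemma pos_of_norm_lt {γ : Loops} {h : Tangent} (hh : ‖h‖ < γ.2.1) : 0 < γ.2.1 + h.2 := by
  have h1 : |h.2| ≤ ‖h‖ := norm_snd_le h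
  linarith [neg_abs_le h.2]

lemma eventually_period_pos {γ : Loops} {h : Tangent} (hh : 0 < γ.2.1 + h.2) :
    ∀ᶠ h' in 𝓝 h, 0 < γ.2.1 + h'.2 :=
  (continuous_const.add continuous_snd).tendsto h |>.eventually (lt_mem_nhds hh)

lemma continuousAt_chart {γ : Loops} {h : Tangent} (hh : 0 < γ.2.1 + h.2) :
    ContinuousAt (chart γ) h := by
  refine ContinuousAt.prodMk ?_ ?_
  · exact (continuous_const.add (continuous_projField.comp continuous_fst)).continuousAt
  · refine Topology.IsInducing.subtypeVal.continuousAt_iff.2 ?_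
    have : ContinuousAt (fun h' : Tangent => γ.2.1 + h'.2) h :=
      (continuous_const.add continuous_snd).continuousAt
    refine this.congr ?_
    filter_upwards [eventually_period_pos hh] with h' hh'
    exact (chart_snd hh').symm

lemma eventually_exists_chart_eq (γ : Loops) {ε : ℝ} (hε : 0 < ε) :
    ∀ᶠ β in 𝓝 γ, ∃ h : Tangent, ‖h‖ < ε ∧ chart γ h = β := by
  have hc1 : Tendsto (fun β : Loops => β.1 - γ.1) (𝓝 γ) (𝓝 0) := by
    have : Continuous (fun β : Loops => β.1 - γ.1) := continuous_fst.sub continuous_const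
    simpa using this.tendsto γ
  have hc2 : Tendsto (fun β : Loops => |β.2.1 - γ.2.1|) (𝓝 γ) (𝓝 0) := by
    have : Continuous (fun β : Loops => |β.2.1 - γ.2.1|) := by fun_prop
    simpa using this.tendsto γ
  filter_upwards [hc1.eventually (eventually_exists_projField_eq hε),
    hc2.eventually (gt_mem_nhds hε)] with β ⟨ξ, hξ, hξβ⟩ hT
  refine ⟨(ξ, β.2.1 - γ.2.1), max_lt hξ hT, Prod.ext ?_ (Subtype.ext ?_)⟩
  · simp [chart, hξβ]
  · rw [chart_snd (by simpa using period_pos β)]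
    simp

lemma chart_injOn {γ : Loops} {h h' : Tangent} (hT : ‖h‖ < γ.2.1) (hT' : ‖h'‖ < γ.2.1)
    (hh : ‖h‖ < 1 / 2) (hh' : ‖h'‖ < 1 / 2) (heq : chart γ h = chart γ h') : h = h' := by
  refine Prod.ext (projField_injOn ((norm_fst_le h).trans_lt hh) ((norm_fst_le h').trans_lt hh') ?_) ?_
  · exact add_left_cancel (congrArg Prod.fst heq)
  · have := congrArg (fun β : Loops => (β.2 : ℝ)) heq
    simp only [chart_snd (pos_of_norm_lt hT), chart_snd (pos_of_norm_lt hT')] at this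
    linarith

lemma eventually_chart_chart {γ : Loops} {h : Tangent} (hh : 0 < γ.2.1 + h.2) :
    ∀ᶠ h' in 𝓝 (0 : Tangent), chart (chart γ h) h' = chart γ (h + h') := by
  have := eventually_period_pos (γ := chart γ h) (h := 0) (by simpa using period_pos (chart γ h))
  filter_upwards [this] with h' hh'
  rw [chart_snd hh] at hh'
  exact chart_chart hh hh'

lemma hasFDerivAt_of_comp_add {E F : Type*} [NormedAddCommGroup E] [NormedSpace ℝ E]
    [NormedAddCommGroup F] [NormedSpace ℝ F] {f : E → F} {L : E →L[ℝ] F} {h : E}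
    (hf : HasFDerivAt (fun k => f (h + k)) L 0) : HasFDerivAt f L h := by
  have h2 : HasFDerivAt (fun k : E => k - h) (ContinuousLinearMap.id ℝ E) h :=
    (hasFDerivAt_id h).sub_const h
  have h3 := HasFDerivAt.comp (f := fun k : E => k - h) (g := fun k => f (h + k))
    h (by simpa using hf) h2
  simpa [Function.comp_def] using h3

lemma hasFDerivAt_comp_chart {f : Loops → ℝ} {γ : Loops} {h : Tangent} (hh : 0 < γ.2.1 + h.2)
    {L : Tangent →L[ℝ] ℝ} (hf : HasFDerivAt (fun h' => f (chart (chart γ h) h')) L 0) :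
    HasFDerivAt (fun h' => f (chart γ h')) L h := by
  refine hasFDerivAt_of_comp_add (E := Tangent) (F := ℝ) ?_
  refine HasFDerivAt.congr_of_eventuallyEq (E := Tangent) (F := ℝ) hf ?_
  filter_upwards [eventually_chart_chart hh] with h' hh'
  rw [hh']

lemma eqOn_ball_of_hasFDerivAt {E : Type*} [NormedAddCommGroup E] [NormedSpace ℝ E] {f g : E → ℝ}
    {r : ℝ} (hder : ∀ h ∈ Metric.ball (0 : E) r, ∃ L : E →L[ℝ] ℝ,
      HasFDerivAt f L h ∧ HasFDerivAt g L h) {h : E} (hh : ‖h‖ < r) :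
    f h - f 0 = g h - g 0 := by
  have hr : 0 < r := (norm_nonneg h).trans_lt hh
  have hder' : ∀ h ∈ Metric.ball (0 : E) r,
      HasFDerivAt (fun h => f h - g h) (0 : E →L[ℝ] ℝ) h := by
    intro h hh
    obtain ⟨L, h1, h2⟩ := hder h hh
    have := h1.sub h2
    rwa [sub_self] at this
  have := (convex_ball (0 : E) r).is_const_of_fderivWithin_eq_zero (𝕜 := ℝ)
    (fun k hk => (hder' k hk).differentiableAt.differentiableWithinAt)
    (fun k hk => (hder' k hk).hasFDerivWithinAt.fderivWithin
      (Metric.isOpen_ball.uniqueDiffWithinAt hk))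
    (Metric.mem_ball_self hr) (by simpa using hh : h ∈ Metric.ball (0 : E) r)
  linarith

/-- Two primitives of the same form differ by a locally constant function. -/
theorem IsPrimitiveOn.eventually_sub_eq {η : OneForm} {f₁ f₂ : Loops → ℝ} {W₁ W₂ : Set Loops}
    (hf₁ : IsPrimitiveOn η f₁ W₁) (hf₂ : IsPrimitiveOn η f₂ W₂) {γ : Loops} (h₁ : W₁ ∈ 𝓝 γ)
    (h₂ : W₂ ∈ 𝓝 γ) : ∀ᶠ β in 𝓝 γ, f₁ β - f₁ γ = f₂ β - f₂ γ := by
  have hc : ContinuousAt (chart γ) 0 := continuousAt_chart (by simpa using period_pos γ)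
  have hW : chart γ ⁻¹' (W₁ ∩ W₂) ∈ 𝓝 (0 : Tangent) :=
    hc.preimage_mem_nhds (by rw [chart_zero]; exact inter_mem h₁ h₂)
  obtain ⟨ε, hε, hball⟩ := (Metric.mem_nhds_iff (α := Tangent)).1 hW
  filter_upwards [eventually_exists_chart_eq γ (lt_min hε (period_pos γ))] with β ⟨h, hh, hβ⟩
  have key := eqOn_ball_of_hasFDerivAt (E := Tangent) (f := fun h => f₁ (chart γ h))
    (g := fun h => f₂ (chart γ h)) (fun h hh => ?_) hh
  · simpa only [chart_zero, hβ] using key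
  · rw [mem_ball_zero_iff] at hh
    have hpos : 0 < γ.2.1 + h.2 := pos_of_norm_lt (hh.trans_le (min_le_right _ _))
    have hmem := hball (mem_ball_zero_iff.2 (hh.trans_le (min_le_left _ _)))
    obtain ⟨L₁, hL₁, he₁⟩ := hf₁ _ hmem.1
    obtain ⟨L₂, hL₂, he₂⟩ := hf₂ _ hmem.2
    have hLL : L₁ = L₂ := ContinuousLinearMap.ext fun k => (he₁ k).trans (he₂ k).symm
    subst hLL
    exact ⟨L₁, hasFDerivAt_comp_chart hpos hL₁, hasFDerivAt_comp_chart hpos hL₂⟩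

/-! ### Pairings of continuous and square-integrable functions -/

section Pairing

variable {E F : Type*} [NormedAddCommGroup E] [NormedSpace ℝ E] [NormedAddCommGroup F]
  [NormedSpace ℝ F]

instance holderConjugate_two_two : ENNReal.HolderConjugate 2 2 := ⟨by
  rw [ENNReal.inv_two_add_inv_two, inv_one]⟩

/-- The pairing `(a, v) ↦ ∫ B (a, v)`. -/
def pairing (B : E →L[ℝ] F →L[ℝ] ℝ) :
    C(UnitAddCircle, E) →L[ℝ] Lp F 2 (volume : Measure UnitAddCircle) →L[ℝ] ℝ :=
  (B.lpPairing volume 2 2).comp (ContinuousMap.toLp 2 volume ℝ)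

lemma pairing_apply (B : E →L[ℝ] F →L[ℝ] ℝ) (a : C(UnitAddCircle, E))
    (v : Lp F 2 (volume : Measure UnitAddCircle)) :
    pairing B a v = ∫ s, B (a s) (v s) := by
  rw [pairing, ContinuousLinearMap.comp_apply, ContinuousLinearMap.lpPairing_eq_integral]
  refine integral_congr_ae ?_
  filter_upwards [ContinuousMap.coeFn_toLp (p := 2) (𝕜 := ℝ) volume a] with s hs
  rw [hs]

lemma integrable_pairing (B : E →L[ℝ] F →L[ℝ] ℝ) (a : C(UnitAddCircle, E))
    (v : Lp F 2 (volume : Measure UnitAddCircle)) :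
    Integrable (fun s => B (a s) (v s)) := by
  have ha : MemLp a 2 (volume : Measure UnitAddCircle) :=
    (memLp_congr_ae (ContinuousMap.coeFn_toLp (p := 2) (𝕜 := ℝ) volume a)).1 (Lp.memLp _)
  exact memLp_one_iff_integrable.1 (B.memLp_of_bilin 1 ha (Lp.memLp v))

variable {G : Type*} [NormedAddCommGroup G] [NormedSpace ℝ G]

/-- The multiplication `(a, v) ↦ B (a, v)` of continuous and square-integrable functions. -/
def multiplier (B : E →L[ℝ] F →L[ℝ] G) :
    C(UnitAddCircle, E) →L[ℝ] Lp F 2 (volume : Measure UnitAddCircle) →L[ℝ]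
      Lp G 2 (volume : Measure UnitAddCircle) :=
  (B.holderL volume ⊤ 2 2).comp (ContinuousMap.toLp ⊤ volume ℝ)

/-- The natural pairing of square-integrable functions with values in a space and its dual. -/
def dualPairing (G : Type*) [NormedAddCommGroup G] [NormedSpace ℝ G] :
    Lp (G →L[ℝ] ℝ) 2 (volume : Measure UnitAddCircle) →L[ℝ]
      Lp G 2 (volume : Measure UnitAddCircle) →L[ℝ] ℝ :=
  (ContinuousLinearMap.id ℝ (G →L[ℝ] ℝ)).lpPairing volume 2 2

lemma coeFn_multiplier (B : E →L[ℝ] F →L[ℝ] G) (a : C(UnitAddCircle, E))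
    (v : Lp F 2 (volume : Measure UnitAddCircle)) :
    multiplier B a v =ᵐ[volume] fun s => B (a s) (v s) := by
  change B.holder 2 (ContinuousMap.toLp ⊤ volume ℝ a) v =ᵐ[volume] fun s => B (a s) (v s)
  filter_upwards [ContinuousLinearMap.coeFn_holder (r := 2) B (ContinuousMap.toLp ⊤ volume ℝ a) v,
    ContinuousMap.coeFn_toLp (p := ⊤) (𝕜 := ℝ) volume a] with s h1 h2
  rw [h1, h2]

lemma dualPairing_multiplier (B : E →L[ℝ] F →L[ℝ] G →L[ℝ] ℝ) (a : C(UnitAddCircle, E))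
    (v : Lp F 2 (volume : Measure UnitAddCircle)) (w : Lp G 2 (volume : Measure UnitAddCircle)) :
    dualPairing G (multiplier B a v) w = ∫ s, B (a s) (v s) (w s) := by
  rw [dualPairing, ContinuousLinearMap.lpPairing_eq_integral]
  refine integral_congr_ae ?_
  filter_upwards [coeFn_multiplier B a v] with s hs
  rw [hs]
  rfl

lemma integrable_multiplier_pairing (B : E →L[ℝ] F →L[ℝ] G →L[ℝ] ℝ) (a : C(UnitAddCircle, E))
    (v : Lp F 2 (volume : Measure UnitAddCircle)) (w : Lp G 2 (volume : Measure UnitAddCircle)) :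
    Integrable (fun s => B (a s) (v s) (w s)) := by
  have h := (memLp_congr_ae (coeFn_multiplier B a v)).1 (Lp.memLp _)
  exact memLp_one_iff_integrable.1
    ((ContinuousLinearMap.id ℝ (G →L[ℝ] ℝ)).memLp_of_bilin 1 h (Lp.memLp w))

end Pairing

/-! ### Integration by parts -/

/-- The standard area form as a continuous bilinear map. -/
def areaCLM : Plane →L[ℝ] Plane →L[ℝ] ℝ :=
  LinearMap.toContinuousLinearMap (LinearMap.toContinuousLinearMap.toLinearMap ∘ₗ
    LinearMap.mk₂ ℝ area (fun u u' v => by simp [area]; ring) (fun c u v => by simp [area]; ring)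
      (fun u v v' => by simp [area]; ring) (fun c u v => by simp [area]; ring))

lemma areaCLM_apply (u v : Plane) : areaCLM u v = area u v := rfl

lemma area_swap (u v : Plane) : area v u = - area u v := by simp [area, mul_comm]

/-- The integral over the circle of the derivative of `Ψ (x, ξ)` along absolutely continuous
curves `x` and `ξ`. -/
lemma integral_fderiv_along (p q : Plane) (v w : L2) {Ψ : Plane × Plane → ℝ}
    (hΨ : ∀ t ∈ Icc (0 : ℝ) 1, ContDiffAt ℝ 1 Ψ (p + displacement v t, q + displacement w t)) :
    ∫ t in (0 : ℝ)..1, fderiv ℝ Ψ (p + displacement v t, q + displacement w t)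
        (v (t : UnitAddCircle), w (t : UnitAddCircle))
      = Ψ (p + displacement v 1, q + displacement w 1) - Ψ (p, q) := by
  have hint : ∀ a b, IntervalIntegrable
      (fun t : ℝ => (v (t : UnitAddCircle), w (t : UnitAddCircle))) volume a b := fun a b =>
    ⟨(intervalIntegrable_vel v a b).1.prodMk (intervalIntegrable_vel w a b).1,
      (intervalIntegrable_vel v a b).2.prodMk (intervalIntegrable_vel w a b).2⟩
  have h := integral_fderiv_comp_primitive (V := Plane × Plane)
    (y := fun t => (p + displacement v t, q + displacement w t)) hint (fun t => ?_) hΨ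
  · simpa [displacement] using h
  · have h1 := (ContinuousLinearMap.fst ℝ Plane Plane).intervalIntegral_comp_comm (hint 0 t)
    have h2 := (ContinuousLinearMap.snd ℝ Plane Plane).intervalIntegral_comp_comm (hint 0 t)
    simp only [ContinuousLinearMap.coe_fst', ContinuousLinearMap.coe_snd'] at h1 h2
    refine Prod.ext ?_ ?_
    · rw [Prod.fst_add, ← h1]; simp [displacement]
    · rw [Prod.snd_add, ← h2]; simp [displacement]

lemma h1Field_displacement_one (ξ : H1Field) : ξ.1.1 0 + displacement ξ.1.2 1 = ξ.1.1 0 := by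
  rw [← ξ.2 1, AddCircle.coe_period]

/-- The derivative of `area ξ ζ` integrates to zero over the circle, and antisymmetry of the area
form turns this into symmetry of the pairing. It expresses the closedness of the area transgression.
-/
lemma pairing_area_comm (ξ ζ : H1Field) :
    pairing areaCLM ξ.1.1 ζ.1.2 = pairing areaCLM ζ.1.1 ξ.1.2 := by
  have hΨ : ∀ z : Plane × Plane, HasFDerivAt (fun z : Plane × Plane => areaCLM z.1 z.2)
      (areaCLM.deriv₂ z) z := fun z => areaCLM.isBoundedBilinearMap.hasFDerivAt z
  have h := integral_fderiv_along (ξ.1.1 0) (ζ.1.1 0) ξ.1.2 ζ.1.2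
    (Ψ := fun z => areaCLM z.1 z.2) (fun t _ => areaCLM.isBoundedBilinearMap.contDiff.contDiffAt)
  rw [h1Field_displacement_one, h1Field_displacement_one, sub_self] at h
  have hξ : ∀ t : ℝ, ξ.1.1 0 + displacement ξ.1.2 t = ξ.1.1 (t : UnitAddCircle) :=
    fun t => (ξ.2 t).symm
  have hζ : ∀ t : ℝ, ζ.1.1 0 + displacement ζ.1.2 t = ζ.1.1 (t : UnitAddCircle) :=
    fun t => (ζ.2 t).symm
  simp only [(hΨ _).fderiv, hξ, hζ] at h
  have h1 := UnitAddCircle.intervalIntegral_preimage 0 fun s =>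
    areaCLM.deriv₂ (ξ.1.1 s, ζ.1.1 s) (ξ.1.2 s, ζ.1.2 s)
  rw [zero_add, h] at h1
  rw [pairing_apply, pairing_apply, ← sub_eq_zero,
    ← integral_sub (integrable_pairing _ _ _) (integrable_pairing _ _ _), h1]
  refine integral_congr_ae (Eventually.of_forall fun s => ?_)
  simp only [ContinuousLinearMap.coe_deriv₂, areaCLM_apply]
  rw [area_swap (ξ.1.2 s), sub_neg_eq_add]

/-- The integrand is the derivative of `θ_x(ξ)` along the loop. -/
lemma integral_torusDeriv_add {q₀ : Torus} {θ : Torus → Plane →L[ℝ] ℝ}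
    (hθ : ContDiffOn ℝ ∞ (fun p : Plane => θ (proj p)) {p | proj p ≠ q₀})
    {γ : Loops} (hγ : γ ∈ avoiding q₀) (ξ : H1Field) :
    ∫ s : UnitAddCircle, (torusDeriv θ (γ.loop s) (γ.vel s) (ξ.1.1 s) + θ (γ.loop s) (ξ.1.2 s)) = 0 := by
  obtain ⟨p, hp⟩ := proj_surjective (γ.loop 0)
  have hloop : ∀ t : ℝ, proj (p + displacement γ.vel t) = γ.loop (t : UnitAddCircle) := fun t => by
    rw [proj_add, hp]; exact (γ.1.2 t).symm
  have hsm : ∀ t : ℝ, ContDiffAt ℝ ∞ (fun p : Plane => θ (proj p)) (p + displacement γ.vel t) :=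
    fun t => contDiffAt_comp_proj (O := {q | q ≠ q₀}) hθ isOpen_ne (by
      rw [hloop]; exact hγ _)
  have h := integral_fderiv_along p (ξ.1.1 0) γ.vel ξ.1.2
    (Ψ := fun z => θ (proj z.1) z.2) (fun t _ => by
      have h1 : ContDiffAt ℝ 1 (fun z : Plane × Plane => θ (proj z.1))
          (p + displacement γ.vel t, ξ.1.1 0 + displacement ξ.1.2 t) :=
        ContDiffAt.comp (g := fun p => θ (proj p)) _ ((hsm t).of_le (by norm_num)) contDiffAt_fst
      exact h1.clm_apply contDiffAt_snd)
  -- The lift of `γ` need not close up, but `Ψ` sees its first argument only through `proj`, so its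
  -- values at the two ends agree.
  rw [h1Field_displacement_one, hloop 1, AddCircle.coe_period, hp, sub_self] at h
  rw [← UnitAddCircle.intervalIntegral_preimage 0 fun s =>
    torusDeriv θ (γ.loop s) (γ.vel s) (ξ.1.1 s) + θ (γ.loop s) (ξ.1.2 s), zero_add]
  refine Eq.trans (intervalIntegral.integral_congr fun t _ => ?_) h
  have h1 := HasFDerivAt.comp (𝕜 := ℝ) (E := Plane × Plane) (f := Prod.fst)
    (g := fun p => θ (proj p)) (p + displacement γ.vel t, ξ.1.1 0 + displacement ξ.1.2 t)
    ((hsm t).differentiableAt (by norm_num)).hasFDerivAt hasFDerivAt_fst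
  have h2 := h1.clm_apply (u := Prod.snd) hasFDerivAt_snd
  have hξ : ξ.1.1 0 + displacement ξ.1.2 t = ξ.1.1 (t : UnitAddCircle) := (ξ.2 t).symm
  simp only [Function.comp_def] at h2
  rw [h2.fderiv]
  simp [← torusDeriv_proj, hloop, hξ, add_comm]

/-! ### Differentiability of the action functional -/

section Generic

variable {H V E F G : Type*} [NormedAddCommGroup H] [NormedSpace ℝ H] [NormedAddCommGroup V]
  [NormedSpace ℝ V] [NormedAddCommGroup E]
  [NormedSpace ℝ E] [NormedAddCommGroup F] [NormedSpace ℝ F] [NormedAddCommGroup G]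
  [NormedSpace ℝ G]

/-- The shape of `kineticAction` in a chart: `N (a h)` is the metric along the displaced loop, `v +
b h` its velocity, `T + c h` its period. -/
lemma differentiableAt_kinetic_quotient {a : H →L[ℝ] V} {b : H →L[ℝ] F} (c : H →L[ℝ] ℝ)
    {N : V → E} (hN : DifferentiableAt ℝ N 0) (Q : E →L[ℝ] F →L[ℝ] G) (R : G →L[ℝ] F →L[ℝ] ℝ)
    (v : F) {T : ℝ} (hT : T ≠ 0) (k : ℝ) :
    DifferentiableAt ℝ
      (fun h => 1 / 2 * R (Q (N (a h)) (v + b h)) (v + b h) / (T + c h) + k * (T + c h)) 0 := by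
  have h1 : DifferentiableAt ℝ (fun h => N (a h)) 0 := by
    refine DifferentiableAt.comp (g := N) (0 : H) ?_ a.differentiableAt
    rwa [map_zero]
  have h2 : DifferentiableAt ℝ (fun h => v + b h) 0 :=
    (differentiableAt_const v).add b.differentiableAt
  have h3 : DifferentiableAt ℝ (fun h => T + c h) 0 :=
    (differentiableAt_const T).add c.differentiableAt
  have h4 : DifferentiableAt ℝ (fun h => Q (N (a h))) 0 :=
    Q.differentiableAt.comp (0 : H) h1
  have h5 : DifferentiableAt ℝ (fun h => R (Q (N (a h)) (v + b h))) 0 :=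
    R.differentiableAt.comp (0 : H) (h4.clm_apply h2)
  have hT' : T + c 0 ≠ 0 := by simpa using hT
  have h6 : DifferentiableAt ℝ (fun h => 1 / 2 * R (Q (N (a h)) (v + b h)) (v + b h)) 0 :=
    (h5.clm_apply h2).const_mul _
  refine ((h6.mul (h3.inv hT')).add (h3.const_mul k)).congr_of_eventuallyEq
    (Eventually.of_forall fun h => ?_)
  simp [div_eq_mul_inv]

lemma hasFDerivAt_bilinear_comp {a : H →L[ℝ] V} {b : H →L[ℝ] F} {N : V → E} {N' : V →L[ℝ] E}
    (hN : HasFDerivAt N N' 0) (Q : E →L[ℝ] F →L[ℝ] ℝ) (v : F) :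
    ∃ L : H →L[ℝ] ℝ, HasFDerivAt (fun h => Q (N (a h)) (v + b h)) L 0 ∧
      ∀ h, L h = Q (N' (a h)) v + Q (N 0) (b h) := by
  have h1 : HasFDerivAt (fun h => N (a h)) (N'.comp a) 0 := by
    refine HasFDerivAt.comp (g := N) (0 : H) ?_ a.hasFDerivAt
    rwa [map_zero]
  have h2 : HasFDerivAt (fun h => v + b h) b 0 := b.hasFDerivAt.const_add v
  have h3 := Q.hasFDerivAt.comp (0 : H) h1
  refine ⟨_, h3.clm_apply h2, fun h => ?_⟩
  simp [add_comm]

lemma hasFDerivAt_quadratic {a : H →L[ℝ] V} {b : H →L[ℝ] F} (Q : V →L[ℝ] F →L[ℝ] ℝ) (v : F)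
    (h₀ : H) : ∃ L : H →L[ℝ] ℝ,
      HasFDerivAt (fun h => Q (a (h₀ + h)) v + 1 / 2 * Q (a (h₀ + h)) (b (h₀ + h))) L 0 ∧
      ∀ h, L h = Q (a h) v + 1 / 2 * (Q (a h₀) (b h) + Q (a h) (b h₀)) := by
  have h0 : HasFDerivAt (fun h : H => h₀ + h) (ContinuousLinearMap.id ℝ H) 0 :=
    (hasFDerivAt_id _).const_add _
  have h1 := Q.hasFDerivAt.comp (0 : H) (a.hasFDerivAt.comp (0 : H) h0)
  have h2 := b.hasFDerivAt.comp (0 : H) h0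
  refine ⟨_, (h1.clm_apply (hasFDerivAt_const v _)).add ((h1.clm_apply h2).const_mul (1 / 2)),
    fun h => ?_⟩
  simp [mul_add]

lemma hasFDerivAt_const_add_clm (T : ℝ) (c : H →L[ℝ] ℝ) :
    HasFDerivAt (fun h => T + c h) c 0 :=
  c.hasFDerivAt.const_add T

lemma hasFDerivAt_sub_const_mul {f p : H → ℝ} {L c : H →L[ℝ] ℝ} (hf : HasFDerivAt f L 0)
    (hp : HasFDerivAt p c 0) (e : ℝ) : ∃ L' : H →L[ℝ] ℝ,
      HasFDerivAt (fun h => f h - e * p h) L' 0 ∧ ∀ h, L' h = L h - e * c h :=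
  ⟨_, hf.sub (hp.const_mul e), fun h => by simp⟩

end Generic

/-- The field component of a tangent vector. -/
def fieldCLM : Tangent →L[ℝ] C(UnitAddCircle, Plane) :=
  (ContinuousLinearMap.fst ℝ (C(UnitAddCircle, Plane)) L2).comp
    (h1Fields.subtypeL.comp (ContinuousLinearMap.fst ℝ H1Field ℝ))

/-- The derivative of the field component of a tangent vector. -/
def velCLM : Tangent →L[ℝ] L2 :=
  (ContinuousLinearMap.snd ℝ (C(UnitAddCircle, Plane)) L2).comp
    (h1Fields.subtypeL.comp (ContinuousLinearMap.fst ℝ H1Field ℝ))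

/-- The period component of a tangent vector. -/
def periodCLM : Tangent →L[ℝ] ℝ := ContinuousLinearMap.snd ℝ H1Field ℝ

lemma eventually_fieldCLM {P : C(UnitAddCircle, Plane) → Prop} (hP : ∀ᶠ ξ in 𝓝 0, P ξ) :
    ∀ᶠ h in 𝓝 (0 : Tangent), P (fieldCLM h) := by
  have := fieldCLM.continuous.tendsto 0
  rw [map_zero] at this
  exact this.eventually hP

lemma eventually_period_chart (γ : Loops) :
    ∀ᶠ h in 𝓝 (0 : Tangent), (chart γ h).period = γ.period + periodCLM h := by
  filter_upwards [eventually_period_pos (γ := γ) (h := 0) (by simpa using period_pos γ)] with h hh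
  exact chart_snd hh

/-- The metric is smooth on the whole torus. -/
lemma TorusMetric.contDiffOn (g : TorusMetric) :
    ContDiffOn ℝ ∞ (fun p => g.val (proj p)) {p | proj p ∈ (univ : Set Torus)} :=
  g.smooth.contDiffOn

lemma differentiableAt_quadratic_action {E : Type*} [NormedAddCommGroup E] [NormedSpace ℝ E]
    (B : E →L[ℝ] Plane →L[ℝ] Plane →L[ℝ] ℝ) {A : Torus → E}
    (hA : ContDiffOn ℝ ∞ (fun p => A (proj p)) {p | proj p ∈ (univ : Set Torus)}) (k : ℝ)
    (γ : Loops) : DifferentiableAt ℝ (fun h =>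
      (1 / 2) * (∫ s, B (A ((chart γ h).loop s)) ((chart γ h).vel s) ((chart γ h).vel s))
        / (chart γ h).period + k * (chart γ h).period) 0 := by
  have hN := (hasFDerivAt_superposition (x := γ.loop) hA isOpen_univ
    fun _ => mem_univ _).differentiableAt
  have h := differentiableAt_kinetic_quotient (H := Tangent) (a := fieldCLM) (b := velCLM)
    periodCLM hN (multiplier B) (dualPairing Plane) γ.vel (period_pos γ).ne' k
  refine DifferentiableAt.congr_of_eventuallyEq (E := Tangent) h ?_
  filter_upwards [eventually_period_chart γ, eventually_fieldCLM
    (eventually_superposition_apply (x := γ.loop) hA isOpen_univ fun _ => mem_univ _)]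
    with h h1 h2
  rw [h1, dualPairing_multiplier]
  simp only [h2]
  rfl

/-- Evaluation of bilinear forms. -/
def evalForm : (Plane →L[ℝ] Plane →L[ℝ] ℝ) →L[ℝ] Plane →L[ℝ] Plane →L[ℝ] ℝ :=
  ContinuousLinearMap.id ℝ _

lemma differentiableAt_kineticAction (g : TorusMetric) (k : ℝ) (γ : Loops) :
    DifferentiableAt ℝ (fun h => kineticAction g k (chart γ h)) 0 := by
  have h := differentiableAt_quadratic_action (E := Plane →L[ℝ] Plane →L[ℝ] ℝ) evalForm
    (A := g.val) g.contDiffOn k γ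
  exact h

lemma integrable_quadratic {E : Type*} [NormedAddCommGroup E] [NormedSpace ℝ E]
    (B : E →L[ℝ] Plane →L[ℝ] Plane →L[ℝ] ℝ) {A : Torus → E}
    (hA : ContDiffOn ℝ ∞ (fun p => A (proj p)) {p | proj p ∈ (univ : Set Torus)}) (γ : Loops) :
    Integrable fun s => B (A (γ.loop s)) (γ.vel s) (γ.vel s) :=
  integrable_multiplier_pairing B
    ⟨fun s => A (γ.loop s), continuous_iff_continuousAt.2 fun _ =>
      (continuousAt_of_contDiffOn hA isOpen_univ (mem_univ _)).comp
        γ.loop.continuous.continuousAt⟩ γ.vel γ.vel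

/-- The integral of a 1-form over a loop. -/
def formIntegral (θ : Torus → Plane →L[ℝ] ℝ) (γ : Loops) : ℝ :=
  ∫ s : UnitAddCircle, θ (γ.loop s) (γ.vel s)

lemma isOpen_avoiding (q₀ : Torus) : IsOpen (avoiding q₀) := by
  have hc : Continuous fun γ : Loops => γ.1.1.1 :=
    continuous_fst.comp (continuous_subtype_val.comp continuous_fst)
  have h := (ContinuousMap.isOpen_setOfPred_mapsTo (isCompact_univ (X := UnitAddCircle))
    (isOpen_ne (x := q₀))).preimage hc
  convert! h using 1
  ext γ
  exact ⟨fun hγ s _ => hγ s, fun hγ s => hγ (mem_univ s)⟩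

/-- A form which is continuous away from a point, along a loop avoiding it. -/
def formAlong {q₀ : Torus} {θ : Torus → Plane →L[ℝ] ℝ}
    (hθ : ContDiffOn ℝ ∞ (fun p : Plane => θ (proj p)) {p | proj p ≠ q₀}) {γ : Loops}
    (hγ : γ ∈ avoiding q₀) : C(UnitAddCircle, Plane →L[ℝ] ℝ) :=
  ⟨fun s => θ (γ.loop s), continuous_iff_continuousAt.2 fun s =>
    (continuousAt_of_contDiffOn (O := {q | q ≠ q₀}) hθ isOpen_ne (hγ s)).comp
      γ.loop.continuous.continuousAt⟩

lemma integrable_form {q₀ : Torus} {θ : Torus → Plane →L[ℝ] ℝ}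
    (hθ : ContDiffOn ℝ ∞ (fun p : Plane => θ (proj p)) {p | proj p ≠ q₀}) {γ : Loops}
    (hγ : γ ∈ avoiding q₀) (v : L2) : Integrable fun s => θ (γ.loop s) (v s) :=
  integrable_pairing (ContinuousLinearMap.id ℝ (Plane →L[ℝ] ℝ)) (formAlong hθ hγ) v

lemma integrable_metric (g : TorusMetric) (γ : Loops) :
    Integrable fun s => g.val (γ.loop s) (γ.vel s) (γ.vel s) := by
  have h := integrable_quadratic (E := Plane →L[ℝ] Plane →L[ℝ] ℝ) evalForm
    (A := g.val) g.contDiffOn γ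
  exact h

lemma freeAction_integrand (g : TorusMetric) (θ : Torus → Plane →L[ℝ] ℝ) (k : ℝ) (γ : Loops) :
    (fun s : UnitAddCircle => (1 / 2) * g.val (γ.loop s) (γ.period⁻¹ • γ.vel s)
      (γ.period⁻¹ • γ.vel s) + θ (γ.loop s) (γ.period⁻¹ • γ.vel s) + k) = fun s =>
      (1 / 2 * γ.period⁻¹ * γ.period⁻¹) * g.val (γ.loop s) (γ.vel s) (γ.vel s) +
        γ.period⁻¹ * θ (γ.loop s) (γ.vel s) + k := by
  ext s
  simp
  ring

lemma integrable_freeAction_integrand (g : TorusMetric) {q₀ : Torus} {θ : Torus → Plane →L[ℝ] ℝ}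
    (hθ : ContDiffOn ℝ ∞ (fun p : Plane => θ (proj p)) {p | proj p ≠ q₀}) (k : ℝ) {γ : Loops}
    (hγ : γ ∈ avoiding q₀) :
    Integrable fun s : UnitAddCircle => (1 / 2) * g.val (γ.loop s) (γ.period⁻¹ • γ.vel s)
      (γ.period⁻¹ • γ.vel s) + θ (γ.loop s) (γ.period⁻¹ • γ.vel s) + k := by
  rw [freeAction_integrand]
  exact (((integrable_metric g γ).const_mul _).add
    ((integrable_form hθ hγ γ.vel).const_mul _)).add (integrable_const k)

lemma freeAction_eq (g : TorusMetric) {q₀ : Torus} {θ : Torus → Plane →L[ℝ] ℝ}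
    (hθ : ContDiffOn ℝ ∞ (fun p : Plane => θ (proj p)) {p | proj p ≠ q₀}) (k : ℝ) {γ : Loops}
    (hγ : γ ∈ avoiding q₀) :
    freeAction g θ k γ = kineticAction g k γ + formIntegral θ γ := by
  have ha := integrable_metric g γ
  have hb := integrable_form hθ hγ γ.vel
  have hT : γ.period ≠ 0 := (period_pos γ).ne'
  have hab : Integrable fun s =>
      (1 / 2 * γ.period⁻¹ * γ.period⁻¹) * g.val (γ.loop s) (γ.vel s) (γ.vel s) +
        γ.period⁻¹ * θ (γ.loop s) (γ.vel s) := (ha.const_mul _).add (hb.const_mul _)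
  rw [freeAction, freeAction_integrand, integral_add hab (integrable_const k),
    integral_add (ha.const_mul _) (hb.const_mul _), integral_const_mul, integral_const_mul,
    kineticAction, kinetic, formIntegral]
  simp
  field_simp
  ring

/-- The left side is the first variation of `∫ θ_x(x')`. Integrating the second term by parts
replaces it by minus the transposed derivative of `θ`, and the antisymmetrized derivative is `dθ =
σ`. -/
lemma integral_formDeriv_eq_transgression {σ : TwoForm} {q₀ : Torus} {θ : Torus → Plane →L[ℝ] ℝ}
    (hθ : IsPrimitiveAway σ q₀ θ) {γ : Loops} (hγ : γ ∈ avoiding q₀) (h : Tangent) :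
    (∫ s : UnitAddCircle, torusDeriv θ (γ.loop s) (h.1.1.1 s) (γ.vel s))
      + ∫ s : UnitAddCircle, θ (γ.loop s) (h.1.1.2 s) = transgression σ γ h := by
  let D := derivAlong (A := θ) (O := {q | q ≠ q₀}) hθ.smooth isOpen_ne hγ
  let Df : C(UnitAddCircle, Plane →L[ℝ] ℝ) :=
    ⟨fun s => (D s).flip (h.1.1.1 s),
      ((ContinuousLinearMap.flipₗᵢ ℝ Plane Plane ℝ).continuous.comp D.continuous).clm_apply
        h.1.1.1.continuous⟩
  have h1 : Integrable fun s => torusDeriv θ (γ.loop s) (h.1.1.1 s) (γ.vel s) :=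
    integrable_pairing (ContinuousLinearMap.id ℝ (Plane →L[ℝ] ℝ)) (pointwiseApply D h.1.1.1) γ.vel
  have h2 := integrable_form hθ.smooth hγ h.1.1.2
  have h3 : Integrable fun s => torusDeriv θ (γ.loop s) (γ.vel s) (h.1.1.1 s) :=
    integrable_pairing (ContinuousLinearMap.id ℝ (Plane →L[ℝ] ℝ)) Df γ.vel
  have h4 : ∀ s, σ.eval (γ.loop s) (h.1.1.1 s) (γ.vel s) =
      torusDeriv θ (γ.loop s) (h.1.1.1 s) (γ.vel s)
        - torusDeriv θ (γ.loop s) (γ.vel s) (h.1.1.1 s) := by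
    intro s
    obtain ⟨p, hp⟩ := proj_surjective (γ.loop s)
    rw [← hp, torusDeriv_proj]
    exact (hθ.d_eq p (hp ▸ hγ s) _ _).symm
  have h5 := integral_torusDeriv_add hθ.smooth hγ h.1
  rw [integral_add h3 h2] at h5
  simp only [transgression, h4]
  rw [integral_sub h1 h3]
  linarith

theorem isPrimitiveOn_freeAction (g : TorusMetric) {σ : TwoForm} {q₀ : Torus}
    {θ : Torus → Plane →L[ℝ] ℝ} (hθ : IsPrimitiveAway σ q₀ θ) (k : ℝ) :
    IsPrimitiveOn (actionForm g σ k) (freeAction g θ k) (avoiding q₀) := by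
  intro γ hγ
  have hγ' : ∀ s, γ.loop s ∈ {q | q ≠ q₀} := hγ
  have hθ' : ContDiffOn ℝ ∞ (fun p => θ (proj p)) {p | proj p ∈ {q | q ≠ q₀}} := hθ.smooth
  have hN := hasFDerivAt_superposition hθ' isOpen_ne hγ'
  obtain ⟨L, hL, hL'⟩ := hasFDerivAt_bilinear_comp (H := Tangent) (a := fieldCLM) (b := velCLM) hN
    (pairing (ContinuousLinearMap.id ℝ (Plane →L[ℝ] ℝ))) γ.vel
  have hk := (differentiableAt_kineticAction g k γ).hasFDerivAt
  refine ⟨_ + L, HasFDerivAt.congr_of_eventuallyEq (E := Tangent)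
    (HasFDerivAt.add (E := Tangent) hk hL) ?_, fun h => ?_⟩
  · filter_upwards [eventually_fieldCLM (eventually_superposition_apply hθ' isOpen_ne hγ'),
      eventually_fieldCLM (eventually_add_proj_mem isOpen_ne hγ')] with h h1 h2
    have h3 : chart γ h ∈ avoiding q₀ := h2
    rw [freeAction_eq g hθ.smooth k h3, Pi.add_apply, pairing_apply]
    simp only [ContinuousLinearMap.id_apply, h1]
    rfl
  · rw [add_apply, hL', actionForm,
      ← integral_formDeriv_eq_transgression hθ hγ, pairing_apply, pairing_apply]
    have h0 : ∀ s, superposition θ γ.loop 0 s = θ (γ.loop s) := fun s => by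
      rw [(eventually_superposition_apply hθ' isOpen_ne hγ').self_of_nhds s]
      simp [proj_zero]
    simp only [ContinuousLinearMap.id_apply, h0]
    rfl

/-- The energy enters `kineticAction` only through the exact summand `k * T`. -/
theorem IsPrimitiveOn.change_energy {g : TorusMetric} {σ : TwoForm} {k : ℝ} {f : Loops → ℝ}
    {W : Set Loops} (hf : IsPrimitiveOn (actionForm g σ k) f W) (k' : ℝ) :
    IsPrimitiveOn (actionForm g σ k') (fun γ => f γ - (k - k') * γ.period) W := by
  intro γ hγ
  obtain ⟨L, hL, hL'⟩ := hf γ hγ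
  have hper : HasFDerivAt (fun h => (chart γ h).period) periodCLM 0 :=
    HasFDerivAt.congr_of_eventuallyEq (E := Tangent)
      (hasFDerivAt_const_add_clm (H := Tangent) γ.period periodCLM)
      (eventually_period_chart γ)
  obtain ⟨L₁, hL₁, hL₁'⟩ := hasFDerivAt_sub_const_mul (H := Tangent) hL hper (k - k')
  refine ⟨L₁, hL₁, fun h => ?_⟩
  have hk := (differentiableAt_kineticAction g k γ).hasFDerivAt
  obtain ⟨L₂, hL₂, hL₂'⟩ := hasFDerivAt_sub_const_mul (H := Tangent) hk hper (k - k')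
  have heq : (fun h => kineticAction g k' (chart γ h)) = fun h => kineticAction g k (chart γ h) -
      (k - k') * (chart γ h).period := by
    ext h
    simp only [kineticAction]
    ring
  rw [hL₁', hL', actionForm, actionForm, heq, hL₂.fderiv, hL₂']
  ring

/-- The transgression of the standard area form has local primitives. -/
theorem exists_isPrimitiveOn_transgression_stdArea (γ : Loops) :
    ∃ (W : Set Loops) (f : Loops → ℝ), IsOpen W ∧ γ ∈ W ∧
      IsPrimitiveOn (transgression stdArea) f W := by
  -- Radius `1 / 2` makes the chart injective; radius at most the period keeps all periods positive.
  set r := min (1 / 2) γ.2.1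
  have hr0 : 0 < r := lt_min (by norm_num) (period_pos γ)
  -- The radial primitive of the Poincaré lemma: in the chart the form is affine in the base point,
  -- and integrating it along `t ↦ t • h` yields the factor `1 / 2`.
  let Φ : Tangent → ℝ := fun h => pairing areaCLM (fieldCLM h) γ.vel
    + 1 / 2 * pairing areaCLM (fieldCLM h) (velCLM h)
  classical
  let f : Loops → ℝ := fun β =>
    if hβ : ∃ h : Tangent, ‖h‖ < r ∧ chart γ h = β then Φ hβ.choose else 0
  have hfΦ : ∀ h : Tangent, ‖h‖ < r → f (chart γ h) = Φ h := by
    intro h hh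
    have hex : ∃ h' : Tangent, ‖h'‖ < r ∧ chart γ h' = chart γ h := ⟨h, hh, rfl⟩
    have h1 : f (chart γ h) = Φ hex.choose := dif_pos hex
    rw [h1, chart_injOn (hex.choose_spec.1.trans_le (min_le_right _ _))
      (hh.trans_le (min_le_right _ _)) (hex.choose_spec.1.trans_le (min_le_left _ _))
      (hh.trans_le (min_le_left _ _)) hex.choose_spec.2]
  have hpos : ∀ h : Tangent, ‖h‖ < r → 0 < γ.2.1 + h.2 := fun h hh =>
    pos_of_norm_lt (hh.trans_le (min_le_right _ _))
  refine ⟨{β | ∃ h : Tangent, ‖h‖ < r ∧ chart γ h = β}, f, ?_,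
    ⟨0, by rwa [norm_zero (E := Tangent)], chart_zero γ⟩, ?_⟩
  · refine isOpen_iff_mem_nhds.2 ?_
    rintro _ ⟨h₀, hh₀, rfl⟩
    have h1 : 0 < min (r - ‖h₀‖) (chart γ h₀).2.1 := lt_min (by linarith) (period_pos _)
    filter_upwards [eventually_exists_chart_eq (chart γ h₀) h1] with β ⟨h, hh, hβ⟩
    have h2 : ‖h₀ + h‖ < r := by
      linarith [norm_add_le h₀ h, hh.trans_le (min_le_left _ _)]
    refine ⟨h₀ + h, h2, ?_⟩
    rw [← hβ, chart_chart (hpos _ hh₀)]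
    rw [add_assoc]
    exact hpos _ h2
  · rintro _ ⟨h₀, hh₀, rfl⟩
    obtain ⟨L, hL, hL'⟩ := hasFDerivAt_quadratic (H := Tangent) (a := fieldCLM) (b := velCLM)
      (pairing areaCLM) γ.vel h₀
    have hnear : ∀ᶠ h in 𝓝 (0 : Tangent), ‖h‖ < r - ‖h₀‖ := by
      have : Continuous fun h : Tangent => ‖h‖ := continuous_norm (E := Tangent)
      exact this.tendsto 0 |>.eventually (gt_mem_nhds (by rw [norm_zero (E := Tangent)]; linarith))
    refine ⟨L, HasFDerivAt.congr_of_eventuallyEq (E := Tangent) hL ?_, fun h => ?_⟩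
    · filter_upwards [hnear, eventually_chart_chart (hpos _ hh₀)] with h h1 h2
      rw [h2, hfΦ _ (by linarith [norm_add_le h₀ h])]
    -- Symmetry merges the two halves of the derivative of the quadratic term.
    · have h1 : pairing areaCLM (fieldCLM h₀) (velCLM h) = pairing areaCLM (fieldCLM h) (velCLM h₀) :=
        pairing_area_comm h₀.1 h.1
      have h2 : transgression stdArea (chart γ h₀) h
          = pairing areaCLM (fieldCLM h) (γ.vel + velCLM h₀) := by
        rw [pairing_apply]
        simp only [transgression, TwoForm.eval, stdArea, one_mul, areaCLM_apply]
        rfl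
      rw [hL', h1, h2, map_add]
      ring

/-! ### Integrals of closed forms along paths -/

/-- The clamped parameters `l` and `r` each stand still on the half belonging to the other path, so
`F₁ ∘ l + F₂ ∘ r` is the integral. The last clause lets bounds be checked on each piece. -/
lemma isIntegralAlong_trans {η : OneForm} {a b c : Loops} {p : Path a b} {q : Path b c}
    {F₁ F₂ : unitInterval → ℝ} (h₁ : IsIntegralAlong η p.toContinuousMap F₁)
    (h₂ : IsIntegralAlong η q.toContinuousMap F₂) :
    ∃ F, IsIntegralAlong η (p.trans q).toContinuousMap F ∧ F 1 = F₁ 1 + F₂ 1 ∧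
      ∀ s, (∃ t, F s = F₁ t) ∨ ∃ t, F s = F₁ 1 + F₂ t := by
  let l : unitInterval → unitInterval := fun s => projIcc 0 1 zero_le_one (2 * s)
  let r : unitInterval → unitInterval := fun s => projIcc 0 1 zero_le_one (2 * s - 1)
  have hl : Continuous l := continuous_projIcc.comp (by fun_prop)
  have hr : Continuous r := continuous_projIcc.comp (by fun_prop)
  have hl1 : ∀ s : unitInterval, (1 / 2 : ℝ) ≤ s → l s = 1 := fun s hs =>
    projIcc_of_right_le _ (by linarith)
  have hr0 : ∀ s : unitInterval, (s : ℝ) ≤ 1 / 2 → r s = 0 := fun s hs =>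
    projIcc_of_le_left _ (by linarith)
  have hv₁ : ∀ s : unitInterval, (s : ℝ) ≤ 1 / 2 → (p.trans q) s = p (l s) := fun s hs =>
    if_pos hs
  have hv₂ : ∀ s : unitInterval, (1 / 2 : ℝ) ≤ s → (p.trans q) s = q (r s) := fun s hs => by
    rcases hs.eq_or_lt with hs | hs
    · rw [hv₁ s hs.ge, hl1 s hs.le, hr0 s hs.ge, p.target, q.source]
    · exact if_neg hs.not_ge
  let F : unitInterval → ℝ := fun s => F₁ (l s) + F₂ (r s)
  have hF₁ : ∀ s : unitInterval, (s : ℝ) ≤ 1 / 2 → F s = F₁ (l s) := fun s hs => by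
    simp only [F, hr0 s hs, h₂.1, add_zero]
  have hF₂ : ∀ s : unitInterval, (1 / 2 : ℝ) ≤ s → F s = F₁ 1 + F₂ (r s) := fun s hs => by
    simp only [F, hl1 s hs]
  have hr1 : r 1 = 1 := projIcc_of_right_le _ (by simp; norm_num)
  have hl0 : l 0 = 0 := projIcc_of_le_left _ (by simp)
  refine ⟨F, ⟨by rw [hF₁ 0 (by simp), hl0, h₁.1], fun s₀ => ?_⟩,
    by rw [hF₂ 1 (by simp; norm_num), hr1], fun s => ?_⟩
  · rcases lt_trichotomy (s₀ : ℝ) (1 / 2) with hs₀ | hs₀ | hs₀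
    · obtain ⟨W, f, hW, hmem, hf, hev⟩ := h₁.2 (l s₀)
      refine ⟨W, f, hW, ?_, hf, ?_⟩
      · change (p.trans q) s₀ ∈ W
        rw [hv₁ s₀ hs₀.le]; exact hmem
      · filter_upwards [hl.tendsto s₀ |>.eventually hev,
          continuous_subtype_val.tendsto s₀ |>.eventually (gt_mem_nhds hs₀)] with s h1 h2
        change F s - F s₀ = f ((p.trans q) s) - f ((p.trans q) s₀)
        rw [hF₁ s h2.le, hF₁ s₀ hs₀.le, hv₁ s h2.le, hv₁ s₀ hs₀.le]
        exact h1
    -- At the junction the pieces bring different local primitives. These have equal increments near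
    -- the common point, so the first one serves both sides.
    · obtain ⟨W₁, f₁, hW₁, hmem₁, hf₁, hev₁⟩ := h₁.2 (l s₀)
      obtain ⟨W₂, f₂, hW₂, hmem₂, hf₂, hev₂⟩ := h₂.2 (r s₀)
      have hb₁ : p (l s₀) = (p.trans q) s₀ := (hv₁ s₀ hs₀.le).symm
      have hb₂ : q (r s₀) = (p.trans q) s₀ := (hv₂ s₀ hs₀.ge).symm
      have hmem₁' : (p.trans q) s₀ ∈ W₁ := hb₁ ▸ hmem₁
      have hmem₂' : (p.trans q) s₀ ∈ W₂ := hb₂ ▸ hmem₂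
      have hconst := hf₁.eventually_sub_eq hf₂ (hW₁.mem_nhds hmem₁') (hW₂.mem_nhds hmem₂')
      refine ⟨W₁, f₁, hW₁, hmem₁', hf₁, ?_⟩
      filter_upwards [hl.tendsto s₀ |>.eventually hev₁, hr.tendsto s₀ |>.eventually hev₂,
        (p.trans q).continuous.tendsto s₀ |>.eventually hconst] with s h1 h2 h3
      change F₁ (l s) - F₁ (l s₀) = f₁ (p (l s)) - f₁ (p (l s₀)) at h1
      change F₂ (r s) - F₂ (r s₀) = f₂ (q (r s)) - f₂ (q (r s₀)) at h2
      change F s - F s₀ = f₁ ((p.trans q) s) - f₁ ((p.trans q) s₀)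
      rcases le_total (s : ℝ) (1 / 2) with hs | hs
      · rw [hF₁ s hs, hF₁ s₀ hs₀.le, h1, hv₁ s hs, hb₁]
      · rw [h3, hF₂ s hs, hF₂ s₀ hs₀.ge, add_sub_add_left_eq_sub, h2, hv₂ s hs, hb₂]
    · obtain ⟨W, f, hW, hmem, hf, hev⟩ := h₂.2 (r s₀)
      refine ⟨W, f, hW, ?_, hf, ?_⟩
      · change (p.trans q) s₀ ∈ W
        rw [hv₂ s₀ hs₀.le]; exact hmem
      · filter_upwards [hr.tendsto s₀ |>.eventually hev,
          continuous_subtype_val.tendsto s₀ |>.eventually (lt_mem_nhds hs₀)] with s h1 h2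
        change F s - F s₀ = f ((p.trans q) s) - f ((p.trans q) s₀)
        rw [hF₂ s h2.le, hF₂ s₀ hs₀.le, hv₂ s h2.le, hv₂ s₀ hs₀.le, add_sub_add_left_eq_sub]
        exact h1
  · rcases le_total (s : ℝ) (1 / 2) with hs | hs
    · exact Or.inl ⟨_, hF₁ s hs⟩
    · exact Or.inr ⟨_, hF₂ s hs⟩

lemma isIntegralAlong_symm {η : OneForm} {a b : Loops} {p : Path a b} {F : unitInterval → ℝ}
    (h : IsIntegralAlong η p.toContinuousMap F) :
    IsIntegralAlong η p.symm.toContinuousMap fun s => F (unitInterval.symm s) - F 1 := by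
  refine ⟨by simp, fun s₀ => ?_⟩
  obtain ⟨W, f, hW, hmem, hf, hev⟩ := h.2 (unitInterval.symm s₀)
  refine ⟨W, f, hW, hmem, hf, ?_⟩
  filter_upwards [unitInterval.continuous_symm.tendsto s₀ |>.eventually hev] with s hs
  rw [sub_sub_sub_cancel_right]
  exact hs

/-- A form with local primitives can be integrated along every path. -/
theorem exists_isIntegralAlong {η : OneForm} (hη : ∀ γ : Loops, ∃ (W : Set Loops) (f : Loops → ℝ),
      IsOpen W ∧ γ ∈ W ∧ IsPrimitiveOn η f W) (u : C(unitInterval, Loops)) :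
    ∃ F, IsIntegralAlong η u F := by
  choose W f hW hmem hf using hη
  -- A subdivision such that each subinterval is mapped into the domain of one primitive; the
  -- integral is extended one subinterval at a time.
  obtain ⟨t, ht0, htm, ⟨N, hN⟩, ht⟩ := exists_monotone_Icc_subset_open_cover_unitInterval
    (c := fun γ => u ⁻¹' W γ) (fun γ => (hW γ).preimage u.continuous)
    (fun s _ => mem_iUnion.2 ⟨u s, hmem _⟩)
  suffices H : ∀ n, ∃ F : unitInterval → ℝ, F 0 = 0 ∧ ∀ s₀ ≤ t n, ∃ (W : Set Loops) (f : Loops → ℝ),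
      IsOpen W ∧ u s₀ ∈ W ∧ IsPrimitiveOn η f W ∧
        ∀ᶠ s in 𝓝 s₀, F s - F s₀ = f (u s) - f (u s₀) by
    obtain ⟨F, hF0, hF⟩ := H N
    exact ⟨F, hF0, fun s₀ => hF s₀ (by rw [hN N le_rfl]; exact unitInterval.le_one')⟩
  intro n
  induction n with
  | zero =>
    refine ⟨fun s => f (u 0) (u s) - f (u 0) (u 0), by simp, fun s₀ hs₀ => ?_⟩
    obtain rfl : s₀ = 0 := le_antisymm (hs₀.trans ht0.le) unitInterval.nonneg'
    exact ⟨W (u 0), f (u 0), hW _, hmem _, hf _, Eventually.of_forall fun s => by simp⟩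
  | succ n ih =>
    obtain ⟨F, hF0, hF⟩ := ih
    obtain ⟨γ, hγ⟩ := ht n
    let F' : unitInterval → ℝ := fun s =>
      if s ≤ t n then F s else F (t n) + (f γ (u s) - f γ (u (t n)))
    have h1 : ∀ s ≤ t n, F' s = F s := fun s hs => if_pos hs
    have h2 : ∀ s, t n ≤ s → F' s = F (t n) + (f γ (u s) - f γ (u (t n))) := fun s hs => by
      rcases hs.eq_or_lt with rfl | hs
      · rw [h1 _ le_rfl]; simp
      · exact if_neg hs.not_ge
    refine ⟨F', by rw [h1 0 unitInterval.nonneg', hF0], fun s₀ hs₀ => ?_⟩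
    rcases lt_trichotomy s₀ (t n) with h | h | h
    · obtain ⟨V, φ, hV, hmV, hφ, hev⟩ := hF s₀ h.le
      refine ⟨V, φ, hV, hmV, hφ, ?_⟩
      filter_upwards [hev, gt_mem_nhds h] with s h3 h4
      rw [h1 s h4.le, h1 s₀ h.le, h3]
    · obtain ⟨V, φ, hV, hmV, hφ, hev⟩ := hF s₀ h.le
      have hmW : u s₀ ∈ W γ := hγ ⟨h.ge, hs₀⟩
      have hconst := hφ.eventually_sub_eq (hf γ) (hV.mem_nhds hmV) ((hW γ).mem_nhds hmW)
      refine ⟨V, φ, hV, hmV, hφ, ?_⟩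
      filter_upwards [hev, u.continuous.tendsto s₀ |>.eventually hconst] with s h3 h4
      rcases le_total s (t n) with h5 | h5
      · rw [h1 s h5, h1 s₀ h.le, h3]
      · rw [h4, h2 s h5, h2 s₀ h.ge, h]
        ring
    · have hmW : u s₀ ∈ W γ := hγ ⟨h.le, hs₀⟩
      refine ⟨W γ, f γ, hW γ, hmW, hf γ, ?_⟩
      filter_upwards [lt_mem_nhds h] with s h3
      rw [h2 s h3.le, h2 s₀ h.le]
      ring

lemma isIntegralAlong_of_isPrimitiveOn {η : OneForm} {f : Loops → ℝ} {W : Set Loops}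
    (hf : IsPrimitiveOn η f W) (hW : IsOpen W) {u : C(unitInterval, Loops)} (hu : ∀ s, u s ∈ W) :
    IsIntegralAlong η u fun s => f (u s) - f (u 0) :=
  ⟨by simp, fun s₀ => ⟨W, f, hW, hu s₀, hf, Eventually.of_forall fun s => by ring⟩⟩

lemma IsIntegralAlong.change_energy {g : TorusMetric} {σ : TwoForm} {k : ℝ}
    {u : C(unitInterval, Loops)} {F : unitInterval → ℝ}
    (hF : IsIntegralAlong (actionForm g σ k) u F) (k' : ℝ) :
    IsIntegralAlong (actionForm g σ k') u
      fun s => F s - (k - k') * ((u s).period - (u 0).period) := by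
  refine ⟨by simp [hF.1], fun s₀ => ?_⟩
  obtain ⟨W, f, hW, hmem, hf, hev⟩ := hF.2 s₀
  refine ⟨W, _, hW, hmem, hf.change_energy k', ?_⟩
  filter_upwards [hev] with s hs
  linear_combination hs

/-! ### Iterates -/

lemma continuous_iterate (n : ℕ+) : Continuous (iterate n) := by
  refine Continuous.prodMk (Continuous.subtype_mk (Continuous.prodMk ?_ ?_) _)
    (Continuous.subtype_mk (by fun_prop) _)
  · have hc : Continuous fun γ : Loops => γ.1.1.1 :=
      continuous_fst.comp (continuous_subtype_val.comp continuous_fst)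
    exact (ContinuousMap.continuous_precomp
      (⟨fun s => (n : ℕ) • s, by fun_prop⟩ : C(UnitAddCircle, UnitAddCircle))).comp hc
  · have hc : Continuous fun γ : Loops => γ.1.1.2 :=
      continuous_snd.comp (continuous_subtype_val.comp continuous_fst)
    exact Continuous.const_smul (M := ℝ) ((Lp.isometry_compMeasurePreserving
      (measurePreserving_nsmul n)).continuous.comp hc) ((n : ℕ) : ℝ)

lemma iterate_mem_avoiding {q₀ : Torus} {γ : Loops} (hγ : γ ∈ avoiding q₀) (n : ℕ+) :
    iterate n γ ∈ avoiding q₀ := fun _ => hγ _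

lemma period_iterate (n : ℕ+) (γ : Loops) : (iterate n γ).period = n * γ.period := rfl

/-- Velocity and period both scale by `n`, so `x' / T` is only reparametrized by the
measure-preserving map `s ↦ n • s`; the factor `n` comes from the period in front of the integral.
-/
lemma freeAction_iterate (g : TorusMetric) {q₀ : Torus} {θ : Torus → Plane →L[ℝ] ℝ}
    (hθ : ContDiffOn ℝ ∞ (fun p : Plane => θ (proj p)) {p | proj p ≠ q₀}) (k : ℝ) {γ : Loops}
    (hγ : γ ∈ avoiding q₀) (n : ℕ+) :
    freeAction g θ k (iterate n γ) = n * freeAction g θ k γ := by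
  have hn : ((n : ℕ) : ℝ) ≠ 0 := by exact_mod_cast n.ne_zero
  have hint := integrable_freeAction_integrand g hθ k hγ
  have hmp := measurePreserving_nsmul n
  have h1 := integral_map (μ := volume) hmp.aemeasurable
    (by rw [hmp.map_eq]; exact hint.aestronglyMeasurable)
  rw [hmp.map_eq] at h1
  rw [freeAction, freeAction, h1, period_iterate, mul_assoc]
  congr 2
  refine integral_congr_ae ?_
  have h2 : (iterate n γ).vel =ᵐ[volume] fun s => ((n : ℕ) : ℝ) • γ.vel ((n : ℕ) • s) := by
    filter_upwards [Lp.coeFn_smul ((n : ℕ) : ℝ) (Lp.compMeasurePreserving _ hmp γ.vel),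
      Lp.coeFn_compMeasurePreserving γ.vel hmp] with s h3 h4
    refine h3.trans ?_
    rw [Pi.smul_apply, h4]
    rfl
  filter_upwards [h2] with s hs
  have h3 : ((n : ℝ) * γ.period)⁻¹ • (iterate n γ).vel s = γ.period⁻¹ • γ.vel ((n : ℕ) • s) := by
    rw [hs, smul_smul]
    congr 1
    field_simp
  rw [h3]
  rfl

lemma freeAction_sub_freeAction (g : TorusMetric) {q₀ : Torus} {θ : Torus → Plane →L[ℝ] ℝ}
    (hθ : ContDiffOn ℝ ∞ (fun p : Plane => θ (proj p)) {p | proj p ≠ q₀}) (k k' : ℝ) {γ : Loops}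
    (hγ : γ ∈ avoiding q₀) :
    freeAction g θ k γ - freeAction g θ k' γ = (k - k') * γ.period := by
  rw [freeAction_eq g hθ k hγ, freeAction_eq g hθ k' hγ, kineticAction, kineticAction]
  ring

/-! ### Monotonicity of the minimax values -/

/-- Conjugating a path of the minimax class at the energy `kp` by an iterated descending path
gives a path of the minimax class at the lower energy `km` with a smaller maximum. -/
theorem exists_mem_minimaxClass_le {g : TorusMetric} {σ : TwoForm} {q₀ : Torus}
    {θ : Torus → Plane →L[ℝ] ℝ} (hθ : IsPrimitiveAway σ q₀ θ) {α : Loops} {U : Set Loops}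
    {n : ℕ+} {km kp : ℝ} (hlt : km < kp) {u : C(unitInterval, Loops)}
    (hu : u ∈ minimaxClass g θ α U n kp) {F : unitInterval → ℝ}
    (hF : IsIntegralAlong (actionForm g σ kp) u F) {β : Loops} (hβ : iterate n β = u 0)
    {w : C(unitInterval, Loops)} (hwa : ∀ s, w s ∈ avoiding q₀)
    (hw0 : w 0 ∈ minimizers g θ U km) (hw1 : w 1 = β)
    (hwle : ∀ s, freeAction g θ km (w s) ≤ freeAction g θ km β) :
    ∃ v ∈ minimaxClass g θ α U n km, ∃ F', IsIntegralAlong (actionForm g σ km) v F' ∧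
      ∀ s, ∃ t, actionAlong g θ km v F' s ≤ actionAlong g θ kp u F t := by
  obtain ⟨hucomp, huclosed, -, G, hG, hG1⟩ := hu
  let p : Path (iterate n (w 0)) (u 0) :=
    { toFun := fun s => iterate n (w s)
      continuous_toFun := (continuous_iterate n).comp w.continuous
      source' := rfl
      target' := by rw [hw1, hβ] }
  let q : Path (u 0) (u 0) := { toContinuousMap := u, source' := rfl, target' := huclosed.symm }
  let v := ((p.trans q).trans p.symm).toContinuousMap
  have hpa : ∀ s, p.toContinuousMap s ∈ avoiding q₀ := fun s => iterate_mem_avoiding (hwa s) n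
  have hua : u 0 ∈ avoiding q₀ := by
    rw [← hβ, ← hw1]
    exact iterate_mem_avoiding (hwa 1) n
  have hpcomp : ∀ s, p s ∈ connectedComponent (iterate n α) := by
    intro s
    rw [connectedComponent_eq (hucomp 0)]
    have h : IsPreconnected (range p) := isPreconnected_range p.continuous
    exact h.subset_connectedComponent ⟨1, p.target⟩ ⟨s, rfl⟩
  have hple : ∀ s, freeAction g θ km (p s) ≤ freeAction g θ km (u 0) := by
    intro s
    change freeAction g θ km (iterate n (w s)) ≤ freeAction g θ km (u 0)
    rw [← hβ, freeAction_iterate g hθ.smooth km (hwa s), freeAction_iterate g hθ.smooth km (hw1 ▸ hwa 1)]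
    exact mul_le_mul_of_nonneg_left (hwle s) (Nat.cast_nonneg _)
  have hu0 := freeAction_sub_freeAction g hθ.smooth kp km hua
  have hT : ∀ γ : Loops, 0 ≤ (kp - km) * γ.period := fun γ =>
    mul_nonneg (by linarith) (period_pos γ).le
  -- Only the existence of this integral matters: its value enters twice with opposite signs.
  obtain ⟨Gp, hGp⟩ := exists_isIntegralAlong exists_isPrimitiveOn_transgression_stdArea
    p.toContinuousMap
  obtain ⟨G₁, hG₁, hG₁1, -⟩ := isIntegralAlong_trans (p := p) (q := q) hGp hG
  obtain ⟨G₂, hG₂, hG₂1, -⟩ := isIntegralAlong_trans hG₁ (isIntegralAlong_symm hGp)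
  have hFp := isIntegralAlong_of_isPrimitiveOn (isPrimitiveOn_freeAction g hθ km)
    (isOpen_avoiding q₀) hpa
  -- Along `p` the form has the free action as a primitive; along `u` the given integral is
  -- corrected by the change of period.
  obtain ⟨F₁, hF₁, hF₁1, hF₁v⟩ := isIntegralAlong_trans (p := p) (q := q) hFp (hF.change_energy km)
  obtain ⟨F₂, hF₂, -, hF₂v⟩ := isIntegralAlong_trans hF₁ (isIntegralAlong_symm hFp)
  refine ⟨v, ⟨?_, ?_, ?_, G₂, hG₂, ?_⟩, F₂, hF₂, fun s => ?_⟩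
  · have hsub : range ((p.trans q).trans p.symm) ⊆ connectedComponent (iterate n α) := by
      rw [Path.trans_range, Path.trans_range, Path.symm_range]
      rintro _ ((⟨s, rfl⟩ | ⟨s, rfl⟩) | ⟨s, rfl⟩)
      exacts [hpcomp s, hucomp s, hpcomp s]
    exact fun s => hsub ⟨s, rfl⟩
  · change ((p.trans q).trans p.symm) 0 = ((p.trans q).trans p.symm) 1
    rw [Path.source, Path.target]
  · change ((p.trans q).trans p.symm) 0 ∈ _
    rw [Path.source]
    exact ⟨w 0, hw0, rfl⟩
  · rw [hG₂1, hG₁1]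
    simpa [hGp.1] using hG1
  · have hv0 : v 0 = p 0 := by
      change ((p.trans q).trans p.symm) 0 = _
      rw [Path.source, Path.source]
    have hp1 : p 1 = u 0 := p.target
    simp only [actionAlong, hv0]
    simp only [Path.coe_toContinuousMap, hp1] at hF₁1 hF₁v hF₂v
    rcases hF₂v s with ⟨t, ht⟩ | ⟨t, ht⟩
    · rcases hF₁v t with ⟨r, hr⟩ | ⟨r, hr⟩
      -- Outward along `p`: the action is at most its value at the base point of `u`, where `F`
      -- vanishes.
      · refine ⟨0, ?_⟩
        rw [ht, hr, hF.1]
        linarith [hple r, hT (u 0)]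
      -- Along `u`: compare at the same parameter; the difference is `(kp - km)` times the current
      -- period.
      · refine ⟨r, ?_⟩
        rw [ht, hr]
        linarith [hT (u r)]
    -- Back along `p`: the action is that of `p` plus `F 1`, the period correction vanishing because
    -- `u` is closed.
    · refine ⟨1, ?_⟩
      rw [ht, hF₁1, ← huclosed]
      linarith [hple (unitInterval.symm t), hT (u 0)]

end MagneticTorus

end

theorem lemma5p5 (g : MagneticTorus.TorusMetric) (σ : MagneticTorus.TwoForm) (hσ : σ.Oscillating)
    (kstar : ℝ) (hk : 0 < kstar)
    (α : MagneticTorus.Loops) (hα : ¬ MagneticTorus.Contractible α)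
    (q₀ : MagneticTorus.Torus) (hq₀ : α ∈ MagneticTorus.avoiding q₀)
    (θ : MagneticTorus.Torus → MagneticTorus.Plane →L[ℝ] ℝ)
    (hθ : MagneticTorus.IsPrimitiveAway σ q₀ θ)
    (hmin : MagneticTorus.IsStrictLocalMinimizer g q₀ θ kstar α)
    (U : Set MagneticTorus.Loops)
    (hU : MagneticTorus.IsMinimizerNeighborhood g q₀ θ kstar α U)
    (I : Set ℝ) (hI : MagneticTorus.IsMinimaxInterval g θ U kstar I)
    (n : ℕ+) (km kp : ℝ) (hkm : km ∈ I) (hkp : kp ∈ I) (hlt : km < kp) :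
    MagneticTorus.minimaxValue g σ θ α U n km ≤ MagneticTorus.minimaxValue g σ θ α U n kp := by
  -- Each pair of a path and an integral on the right is beaten by one on the left. If there is no
  -- such pair, the right side is `⊤`.
  refine le_iInf₂ fun u hu => le_iInf fun F => le_iInf fun hF => ?_
  obtain ⟨β, hβ, hβu⟩ := hu.2.2.1
  obtain ⟨w, hwU, hw0, hw1, hwle⟩ := hI.connect km hkm kp hkp hlt β hβ
  obtain ⟨v, hv, F', hF', hle⟩ := MagneticTorus.exists_mem_minimaxClass_le hθ hlt hu hF hβu
    (fun s => hU.closure_subset (subset_closure (hwU s))) hw0 hw1 hwle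
  refine iInf₂_le_of_le v hv (iInf_le_of_le F' (iInf_le_of_le hF' (iSup_le fun s => ?_)))
  obtain ⟨t, ht⟩ := hle s
  exact (EReal.coe_le_coe_iff.2 ht).trans
    (le_iSup (fun s => ((MagneticTorus.actionAlong g θ kp u F s : ℝ) : EReal)) t)
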